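/- Let $(\mathcal X,\mathscr X)$ be a measurable space (for instance a Borel subset of $\mathbb R^d$), let $Q$ be a Markov kernel on $\mathcal X$ and let $Q_0$ be a probability measure on $\mathcal X$ that is stationary for $Q$, so that $Q_0\otimes Q$ is the law of $(X_t,X_{t+1})$ when $X$ is the stationary Markov process with kernel $Q$; write $\mathbb E^Q[\,\cdot\,|X_t=x]$ for expectation with respect to $X_{t+1}\sim Q(x,\cdot)$. For $r\ge 1$ let $\phi_r(x)=e^{x^r}-1$ $(x\ge 0)$. For a probability measure $\mu$ let $\|f\|_{\phi_r}=\inf\{c>0:\int\phi_r(|f|/c)\,d\mu\le 1\}$, and let $E^{\phi_r}(\mu)$ be the space of ($\mu$-a.e. equivalence classes of) measurable real functions $f$ with $\|f\|_{\phi_r}<\infty$ and $\int\phi_r(|f|/c)\,d\mu<\infty$ for every $c>0$. Write $E^{\phi_r}=E^{\phi_r}(Q_0)$ and $E^{\phi_r}_2=E^{\phi_r}(Q_0\otimes Q)$. Let $\beta\in(0,1)$, $\theta>0$, $\alpha=-\frac{1}{\theta(1-\beta)}$, and let $u\in E^{\phi_r}_2$ for some $r>1$ (Assumption U). Define $$\mathbb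 T f(x)=\beta\log\mathbb E^Q\big[e^{f(X_{t+1})+\alpha u(X_t,X_{t+1})}\,\big|\,X_t=x\big],$$ $$\mathbb D_v f(x)=\beta\,\mathbb E^Q\big[m_v(X_t,X_{t+1})f(X_{t+1})\,\big|\,X_t=x\big],\qquad m_v(X_t,X_{t+1})=\frac{e^{v(X_{t+1})+\alpha u(X_t,X_{t+1})}}{\mathbb E^Q\big[e^{v(X_{t+1})+\alpha u(X_t,X_{t+1})}\big|X_t\big]}.$$ For a linear operator $\mathbb K$ on $E^{\phi_1}$ let $\|\mathbb K\|=\sup\{\|\mathbb Kf\|_{\phi_1}: f\in E^{\phi_1},\ \|f\|_{\phi_1}\le 1\}$ and let $\rho(\mathbb K;E^{\phi_1})=\lim_{n\to\infty}\|\mathbb K^n\|^{1/n}$ be its spectral radius. Then $\mathbb T$ maps $E^{\phi_1}$ into itself, and for each fixed point $v'\in E^{\phi_1}$ of $\mathbb T$ the operator $\mathbb D_{v'}$ maps $E^{\phi_1}$ into itself, is bounded, and the limit defining $\rho(\mathbb D_{v'};E^{\phi_1})$ exists. Call such a fixed point $v'$ stable if $\rho(\mathbb D_{v'};E^{\phi_1})<1$.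 There is a function $v\in E^{\phi_r}$ that is, for each $1<s\le r$, the unique fixed point of $\mathbb T$ in $E^{\phi_s}$, and this $v$ satisfies: 1. $v$ is the smallest fixed point of $\mathbb T:E^{\phi_1}\to E^{\phi_1}$: it is a fixed point there, and $v\le v'$ $Q_0$-a.e. for every fixed point $v'\in E^{\phi_1}$ of $\mathbb T$; 2. $v$ is the unique stable fixed point of $\mathbb T:E^{\phi_1}\to E^{\phi_1}$: $v$ is stable, and every stable fixed point $v'\in E^{\phi_1}$ of $\mathbb T$ equals $v$ $Q_0$-a.e. -/

import Mathlib

open MeasureTheory ProbabilityTheory Filter Topology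
open scoped ENNReal

noncomputable section

namespace RobustValue

section Orlicz

variable {Ω : Type*} [MeasurableSpace Ω]

/-- The Young function `φ_r(x) = exp(x ^ r) - 1` (used at `x ≥ 0`, `r ≥ 1`). -/
def phi (r x : ℝ) : ℝ := Real.exp (x ^ r) - 1

/-- The modular `E^μ[φ_r(|f| / c)]`, as a number in `[0, ∞]`. -/
def modular (r : ℝ) (μ : Measure Ω) (f : Ω → ℝ) (c : ℝ) : ℝ≥0∞ :=
  ∫⁻ ω, ENNReal.ofReal (phi r (|f ω| / c)) ∂μ

/-- The Luxemburg norm `‖f‖_{φ_r} = inf {c > 0 : E^μ[φ_r(|f| / c)] ≤ 1}`, with value `∞`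
when there is no such `c`. -/
def luxNorm (r : ℝ) (μ : Measure Ω) (f : Ω → ℝ) : ℝ≥0∞ :=
  ⨅ (c : ℝ) (_ : 0 < c) (_ : modular r μ f c ≤ 1), ENNReal.ofReal c

/-- `f` represents an element of the Orlicz space `L^{φ_r}(μ)`. -/
def MemOrlicz (r : ℝ) (μ : Measure Ω) (f : Ω → ℝ) : Prop :=
  AEMeasurable f μ ∧ luxNorm r μ f < ∞

/-- `f` represents an element of the Orlicz heart `E^{φ_r}(μ)`. -/
def MemHeart (r : ℝ) (μ : Measure Ω) (f : Ω → ℝ) : Prop :=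
  MemOrlicz r μ f ∧ ∀ c : ℝ, 0 < c → modular r μ f c < ∞

/-- The operator norm of `K` on `E^{φ_s}(μ)`:
`sup {‖K f‖_{φ_s} : f ∈ E^{φ_s}(μ), ‖f‖_{φ_s} ≤ 1}`, in `[0, ∞]`. -/
def heartOpNorm (s : ℝ) (μ : Measure Ω) (K : (Ω → ℝ) → Ω → ℝ) : ℝ≥0∞ :=
  ⨆ (f : Ω → ℝ) (_ : MemHeart s μ f) (_ : luxNorm s μ f ≤ 1), luxNorm s μ (K f)

/-- The sequence `‖K ^ n‖ ^ (1 / n)` of operator norms on `E^{φ_s}(μ)`. -/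
def rootNorm (s : ℝ) (μ : Measure Ω) (K : (Ω → ℝ) → Ω → ℝ) (n : ℕ) : ℝ≥0∞ :=
  heartOpNorm s μ (K^[n]) ^ (1 / (n : ℝ))

/-- The spectral radius `ρ(K; E^{φ_s}(μ)) = lim_n ‖K ^ n‖ ^ (1 / n)`. -/
def heartSpectralRadius (s : ℝ) (μ : Measure Ω) (K : (Ω → ℝ) → Ω → ℝ) : ℝ≥0∞ :=
  limUnder atTop (rootNorm s μ K)

end Orlicz

section Recursion

variable {X : Type*} [MeasurableSpace X]

/-- `α = -1 / (θ (1 - β))`. -/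
def alpha (β θ : ℝ) : ℝ := -(1 / (θ * (1 - β)))

/-- `E^Q[exp(f(X_{t+1}) + α u(X_t, X_{t+1})) | X_t = x]`. -/
def condExpExp (Q : Kernel X X) (u : X × X → ℝ) (β θ : ℝ) (f : X → ℝ) (x : X) : ℝ :=
  ∫ y, Real.exp (f y + alpha β θ * u (x, y)) ∂(Q x)

/-- `T f(x) = β log E^Q[exp(f(X_{t+1}) + α u(X_t, X_{t+1})) | X_t = x]`. -/
def T (Q : Kernel X X) (u : X × X → ℝ) (β θ : ℝ) (f : X → ℝ) (x : X) : ℝ :=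
  β * Real.log (condExpExp Q u β θ f x)

/-- The worst-case belief distortion
`m_v(x, y) = exp(v(y) + α u(x, y)) / E^Q[exp(v(X_{t+1}) + α u(X_t, X_{t+1})) | X_t = x]`. -/
def distortion (Q : Kernel X X) (u : X × X → ℝ) (β θ : ℝ) (v : X → ℝ) (x y : X) : ℝ :=
  Real.exp (v y + alpha β θ * u (x, y)) / condExpExp Q u β θ v x

/-- The subgradient `D_v f(x) = β E^Q[m_v(X_t, X_{t+1}) f(X_{t+1}) | X_t = x]`. -/
def D (Q : Kernel X X) (u : X × X → ℝ) (β θ : ℝ) (v f : X → ℝ) (x : X) : ℝ :=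
  β * ∫ y, distortion Q u β θ v x y * f y ∂(Q x)

/-- `v` represents a fixed point of `T` in `E^{φ_s}(Q₀)`; equality in this space is
`Q₀`-almost everywhere equality. -/
def IsFixedPoint (s : ℝ) (Q₀ : Measure X) (Q : Kernel X X) (u : X × X → ℝ) (β θ : ℝ)
    (v : X → ℝ) : Prop :=
  MemHeart s Q₀ v ∧ T Q u β θ v =ᵐ[Q₀] v

/-- Stability at `v`: `ρ(D_v; E^{φ_1}(Q₀)) < 1`. -/
def IsStable (Q₀ : Measure X) (Q : Kernel X X) (u : X × X → ℝ) (β θ : ℝ) (v : X → ℝ) : Prop :=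
  heartSpectralRadius 1 Q₀ (D Q u β θ v) < 1

end Recursion

end RobustValue

end

/-! Everything rests on one estimate. Under the tilted conditional law with log density `k`, the
Gibbs variational inequality bounds the conditional mean of `f` in absolute value by `log E e^{2k} +
log E e^{|f|}`. Multiply by `b < 1`, exponentiate, use convexity of `exp` with weights `b` and `1 -
b`, and integrate against the invariant law: the quantity `∫ exp |f|` never exceeds the maximum of
its old value and a constant independent of `f` (`exists_integral_exp_tilt_le`). This iterates
without loss.

Stability: taking `β < b < 1`, the iterates of `D_w` have norm at most `C (β/b)^n`, so the spectral
radius is below one for every `w` in `E^{φ_1}` (`isStable_of_memHeart`). Constants give the lower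
bound `β^n`, and Fekete's lemma then gives the limit.

Uniqueness: the log-exp functional is convex, so `T v - T w ≤ D_v (v - w)`. For two fixed points the
positive part `e` of `v - w` satisfies `e ≤ D_v e`, hence `(b/β)^n e` has bounded exponential
integrals for all `n`, which forces `e = 0` (`IsFixedPoint.ae_le`). Exchanging the roles shows that
all fixed points in `E^{φ_1}` agree, so minimality and both uniqueness claims reduce to existence.

Existence: a similar invariant bound holds for `∫ exp ((|f|/c)^r)` under the nonlinear map `T`
(`exists_integral_exp_T_rpow_le`). Monotone iteration from a function with `g ≤ T g` therefore
converges inside `E^{φ_r}`. Such a function is `-W`, where `W` is a fixed point of the operator with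
`u` replaced by `-|u|`; that one is reached from `0` (`exists_fixedPoint`). -/

noncomputable section

namespace RobustValue

/-! ### Orlicz hearts through exponential integrals -/

section Heart

variable {Ω : Type*} [MeasurableSpace Ω] {μ : Measure Ω}

theorem phi_nonneg {r x : ℝ} (hx : 0 ≤ x) : 0 ≤ phi r x := by
  unfold phi
  have := Real.one_le_exp (Real.rpow_nonneg hx r)
  linarith

theorem aemeasurable_exp_rpow {f : Ω → ℝ} (hf : AEMeasurable f μ) (r c : ℝ) :
    AEMeasurable (fun ω => Real.exp ((|f ω| / c) ^ r)) μ :=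
  Real.measurable_exp.comp_aemeasurable
    (((continuous_abs.measurable.comp_aemeasurable hf).div_const c).pow_const r)

theorem integrable_phi_iff [IsFiniteMeasure μ] {f : Ω → ℝ} {r c : ℝ} :
    Integrable (fun ω => phi r (|f ω| / c)) μ ↔
      Integrable (fun ω => Real.exp ((|f ω| / c) ^ r)) μ := by
  constructor
  · intro h
    refine (h.add (integrable_const 1)).congr (ae_of_all _ fun ω => ?_)
    simp [phi]
  · intro h
    exact h.sub (integrable_const 1)

theorem modular_lt_top_iff [IsFiniteMeasure μ] {f : Ω → ℝ} (hf : AEMeasurable f μ) {r c : ℝ}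
    (hc : 0 < c) :
    modular r μ f c < ∞ ↔ Integrable (fun ω => Real.exp ((|f ω| / c) ^ r)) μ := by
  rw [← integrable_phi_iff, ← lintegral_ofReal_ne_top_iff_integrable, lt_top_iff_ne_top]
  · rfl
  · exact ((aemeasurable_exp_rpow hf r c).sub_const 1).aestronglyMeasurable
  · exact ae_of_all _ fun ω => phi_nonneg (by positivity)

/-- Convexity of `exp` together with value zero at the origin; `r ≥ 1` gives `N ≤ N ^ r`. -/
theorem phi_div_le {r x N : ℝ} (hr : 1 ≤ r) (hx : 0 ≤ x) (hN : 1 ≤ N) :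
    phi r (x / N) ≤ phi r x / N := by
  have hN0 : 0 < N := by linarith
  have h1 : (x / N) ^ r ≤ x ^ r / N := by
    rw [Real.div_rpow hx hN0.le]
    gcongr
    simpa using Real.rpow_le_rpow_of_exponent_le hN hr
  have h2 := convexOn_exp.2 (Set.mem_univ (x ^ r)) (Set.mem_univ 0)
    (show 0 ≤ 1 / N by positivity) (show 0 ≤ 1 - 1 / N by
      rw [sub_nonneg, div_le_one hN0]; exact hN) (by ring)
  simp only [smul_eq_mul, mul_zero, add_zero, Real.exp_zero, mul_one] at h2
  unfold phi
  calc Real.exp ((x / N) ^ r) - 1 ≤ Real.exp (1 / N * x ^ r) - 1 := by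
        gcongr; rw [one_div, inv_mul_eq_div]; exact h1
    _ ≤ _ := by
        have : 1 / N * Real.exp (x ^ r) + (1 - 1 / N) - 1 = (Real.exp (x ^ r) - 1) / N := by
          field_simp; ring
        linarith

theorem modular_mul_le {f : Ω → ℝ} {r c N : ℝ} (hr : 1 ≤ r) (hc : 0 < c) (hN : 1 ≤ N) :
    modular r μ f (c * N) ≤ modular r μ f c / ENNReal.ofReal N := by
  have hN0 : 0 < N := by linarith
  unfold modular
  rw [ENNReal.div_eq_inv_mul, ← lintegral_const_mul' _ _ (by simp [hN0])]
  refine lintegral_mono fun ω => ?_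
  rw [← ENNReal.ofReal_inv_of_pos hN0, ← ENNReal.ofReal_mul (by positivity), ← div_div]
  refine ENNReal.ofReal_le_ofReal ?_
  rw [inv_mul_eq_div]
  exact phi_div_le hr (by positivity) hN

theorem luxNorm_le {f : Ω → ℝ} {r c : ℝ} (hc : 0 < c) (h : modular r μ f c ≤ 1) :
    luxNorm r μ f ≤ ENNReal.ofReal c :=
  iInf_le_of_le c <| iInf_le_of_le hc <| iInf_le_of_le h le_rfl

/-- Finite norm comes for free: enlarging the scale by `N` divides the modular by at least `N`, so a
finite modular can be brought below one. -/
theorem memHeart_iff [IsProbabilityMeasure μ] {f : Ω → ℝ} {r : ℝ} (hr : 1 ≤ r) :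
    MemHeart r μ f ↔ AEMeasurable f μ ∧
      ∀ c : ℝ, 0 < c → Integrable (fun ω => Real.exp ((|f ω| / c) ^ r)) μ := by
  constructor
  · rintro ⟨⟨hf, -⟩, h⟩
    exact ⟨hf, fun c hc => (modular_lt_top_iff hf hc).1 (h c hc)⟩
  · rintro ⟨hf, h⟩
    have h' : ∀ c : ℝ, 0 < c → modular r μ f c < ∞ :=
      fun c hc => (modular_lt_top_iff hf hc).2 (h c hc)
    refine ⟨⟨hf, ?_⟩, h'⟩
    set N : ℝ := max 1 (modular r μ f 1).toReal
    have hN : 1 ≤ N := le_max_left _ _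
    have hN0 : 0 < N := by linarith
    refine (luxNorm_le (c := 1 * N) (by linarith) ?_).trans_lt ENNReal.ofReal_lt_top
    refine (modular_mul_le hr one_pos hN).trans ?_
    refine ENNReal.div_le_of_le_mul ?_
    rw [one_mul]
    exact ENNReal.le_ofReal_iff_toReal_le (h' 1 one_pos).ne (by linarith) |>.2 (le_max_right _ _)

theorem luxNorm_congr {r : ℝ} {f g : Ω → ℝ} (h : f =ᵐ[μ] g) : luxNorm r μ f = luxNorm r μ g := by
  have : ∀ c, modular r μ f c = modular r μ g c := fun c =>
    lintegral_congr_ae (h.mono fun ω hω => by simp only [hω])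
  simp [luxNorm, this]

theorem modular_const_mul {r a c : ℝ} (ha : 0 < a) (f : Ω → ℝ) :
    modular r μ (fun ω => a * f ω) (a * c) = modular r μ f c := by
  unfold modular
  congr 1 with ω
  rw [abs_mul, abs_of_pos ha, mul_div_mul_left _ _ ha.ne']

theorem luxNorm_const_mul_le {r a : ℝ} (ha : 0 < a) (f : Ω → ℝ) :
    luxNorm r μ (fun ω => a * f ω) ≤ ENNReal.ofReal a * luxNorm r μ f := by
  conv_rhs => rw [luxNorm]
  rw [ENNReal.mul_iInf_of_ne (by simpa using ha) ENNReal.ofReal_ne_top]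
  refine le_iInf fun c => ?_
  rw [ENNReal.mul_iInf_of_ne (by simpa using ha) ENNReal.ofReal_ne_top]
  refine le_iInf fun hc => ?_
  rw [ENNReal.mul_iInf_of_ne (by simpa using ha) ENNReal.ofReal_ne_top]
  refine le_iInf fun h => ?_
  rw [← ENNReal.ofReal_mul ha.le]
  exact luxNorm_le (by positivity) (by rwa [modular_const_mul ha])

theorem luxNorm_const_mul {r a : ℝ} (ha : 0 < a) (f : Ω → ℝ) :
    luxNorm r μ (fun ω => a * f ω) = ENNReal.ofReal a * luxNorm r μ f := by
  refine (luxNorm_const_mul_le ha f).antisymm ?_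
  have h := luxNorm_const_mul_le (μ := μ) (r := r) (inv_pos.2 ha) (fun ω => a * f ω)
  simp only [inv_mul_cancel_left₀ ha.ne'] at h
  calc ENNReal.ofReal a * luxNorm r μ f
      ≤ ENNReal.ofReal a * (ENNReal.ofReal a⁻¹ * luxNorm r μ fun ω => a * f ω) := by gcongr
    _ = _ := by
      rw [← mul_assoc, ← ENNReal.ofReal_mul ha.le, mul_inv_cancel₀ ha.ne']
      simp

/-- The integral itself is an admissible scale: it is at least one and dominates the modular at
scale one. With `integral_exp_half_le` this lets operator norms be estimated through exponential
integrals. -/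
theorem luxNorm_one_le_integral_exp [IsProbabilityMeasure μ] {f : Ω → ℝ}
    (h : Integrable (fun ω => Real.exp |f ω|) μ) :
    luxNorm 1 μ f ≤ ENNReal.ofReal (∫ ω, Real.exp |f ω| ∂μ) := by
  set N := ∫ ω, Real.exp |f ω| ∂μ
  have hN : 1 ≤ N := by
    have : ∫ _ω, (1 : ℝ) ∂μ ≤ N :=
      integral_mono (integrable_const 1) h fun ω => Real.one_le_exp (abs_nonneg _)
    simpa using this
  have h1 : modular 1 μ f 1 ≤ ENNReal.ofReal N := by
    rw [ofReal_integral_eq_lintegral_ofReal h (ae_of_all _ fun ω => (Real.exp_pos _).le)]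
    exact lintegral_mono fun ω => ENNReal.ofReal_le_ofReal (by simp [phi])
  have h2 := modular_mul_le (μ := μ) (f := f) le_rfl one_pos hN
  rw [one_mul] at h2
  refine luxNorm_le (by linarith) (h2.trans ?_)
  exact ENNReal.div_le_of_le_mul (by simpa using h1)

/-- The factor `1 / 2` leaves room for an admissible scale `c < 2`, so attainment of the infimum is
not needed. -/
theorem integral_exp_half_le [IsProbabilityMeasure μ] {f : Ω → ℝ} (hf : MemHeart 1 μ f)
    (h : luxNorm 1 μ f ≤ 1) : ∫ ω, Real.exp |1 / 2 * f ω| ∂μ ≤ 2 := by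
  have h2 : luxNorm 1 μ f < 2 := h.trans_lt (by norm_num)
  simp only [luxNorm, iInf_lt_iff] at h2
  obtain ⟨c, hc, hc1, hc2⟩ := h2
  have hc2 : c < 2 := by
    have := (ENNReal.ofReal_lt_ofReal_iff (show (0:ℝ) < 2 by norm_num)).1 (by simpa using hc2)
    exact this
  have hi := ((memHeart_iff le_rfl).1 hf).2 c hc
  have h3 : ∫ ω, phi 1 (|f ω| / c) ∂μ ≤ 1 := by
    rw [modular, ← ofReal_integral_eq_lintegral_ofReal (integrable_phi_iff.2 hi)
      (ae_of_all _ fun ω => phi_nonneg (by positivity))] at hc1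
    simpa using hc1
  have h4 : ∫ ω, Real.exp |1 / 2 * f ω| ∂μ ≤ ∫ ω, (phi 1 (|f ω| / c) + 1) ∂μ := by
    refine integral_mono_of_nonneg (ae_of_all _ fun ω => (Real.exp_pos _).le)
      ((integrable_phi_iff.2 hi).add (integrable_const 1)) (ae_of_all _ fun ω => ?_)
    simp only [phi, Real.rpow_one, sub_add_cancel, Real.exp_le_exp, abs_mul]
    rw [abs_of_pos (by norm_num : (0:ℝ) < 1 / 2), one_div, inv_mul_eq_div]
    gcongr
  rw [integral_add (integrable_phi_iff.2 hi) (integrable_const 1)] at h4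
  simp only [integral_const, probReal_univ, smul_eq_mul, mul_one] at h4
  linarith

theorem memHeart_one_iff [IsProbabilityMeasure μ] {f : Ω → ℝ} :
    MemHeart 1 μ f ↔ AEMeasurable f μ ∧ ∀ t : ℝ, Integrable (fun ω => Real.exp (t * |f ω|)) μ := by
  rw [memHeart_iff le_rfl]
  refine and_congr_right fun hf => ⟨fun h t => ?_, fun h c _ => ?_⟩
  · refine (h (max 1 t)⁻¹ (by positivity)).mono'
      (Real.measurable_exp.comp_aemeasurable
        ((continuous_abs.measurable.comp_aemeasurable hf).const_mul t)).aestronglyMeasurable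
      (ae_of_all _ fun ω => ?_)
    rw [Real.norm_eq_abs, Real.abs_exp, Real.rpow_one, div_inv_eq_mul, mul_comm]
    gcongr
    exact le_max_right _ _
  · simpa [div_eq_inv_mul] using h c⁻¹

theorem MemHeart.aemeasurable {r : ℝ} {f : Ω → ℝ} (h : MemHeart r μ f) : AEMeasurable f μ := h.1.1

theorem MemHeart.integrable_exp_mul_abs [IsProbabilityMeasure μ] {f : Ω → ℝ}
    (h : MemHeart 1 μ f) (t : ℝ) : Integrable (fun ω => Real.exp (t * |f ω|)) μ :=
  (memHeart_one_iff.1 h).2 t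

theorem MemHeart.integrable_exp_abs [IsProbabilityMeasure μ] {f : Ω → ℝ}
    (h : MemHeart 1 μ f) : Integrable (fun ω => Real.exp |f ω|) μ := by
  simpa using h.integrable_exp_mul_abs 1

theorem MemHeart.integrable_exp [IsProbabilityMeasure μ] {f : Ω → ℝ}
    (h : MemHeart 1 μ f) : Integrable (fun ω => Real.exp (f ω)) μ := by
  refine h.integrable_exp_abs.mono' (Real.measurable_exp.comp_aemeasurable
    h.aemeasurable).aestronglyMeasurable (ae_of_all _ fun ω => ?_)
  rw [Real.norm_eq_abs, Real.abs_exp]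
  exact Real.exp_le_exp.2 (le_abs_self _)

theorem MemHeart.integrable [IsProbabilityMeasure μ] {f : Ω → ℝ}
    (h : MemHeart 1 μ f) : Integrable f μ := by
  refine h.integrable_exp_abs.mono' h.aemeasurable.aestronglyMeasurable (ae_of_all _ fun ω => ?_)
  rw [Real.norm_eq_abs]
  linarith [Real.add_one_le_exp |f ω|]

theorem memHeart_of_forall_ge [IsProbabilityMeasure μ] {f : Ω → ℝ} (hf : AEMeasurable f μ)
    (h : ∀ t : ℝ, 1 ≤ t → Integrable (fun ω => Real.exp (t * |f ω|)) μ) : MemHeart 1 μ f := by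
  refine memHeart_one_iff.2 ⟨hf, fun t => ?_⟩
  refine (h (max 1 t) (le_max_left _ _)).mono'
      (Real.measurable_exp.comp_aemeasurable
        ((continuous_abs.measurable.comp_aemeasurable hf).const_mul t)).aestronglyMeasurable
      (ae_of_all _ fun ω => ?_)
  rw [Real.norm_eq_abs, Real.abs_exp]
  gcongr
  exact le_max_right _ _

theorem MemHeart.mono [IsProbabilityMeasure μ] {f g : Ω → ℝ} {r : ℝ} (hr : 1 ≤ r)
    (hg : MemHeart r μ g) (hf : AEMeasurable f μ) (h : ∀ᵐ ω ∂μ, |f ω| ≤ |g ω|) :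
    MemHeart r μ f := by
  refine (memHeart_iff hr).2 ⟨hf, fun c hc => ?_⟩
  refine (((memHeart_iff hr).1 hg).2 c hc).mono' (aemeasurable_exp_rpow hf r c).aestronglyMeasurable
    (h.mono fun ω hω => ?_)
  rw [Real.norm_eq_abs, Real.abs_exp]
  gcongr

theorem MemHeart.mono_exponent [IsProbabilityMeasure μ] {f : Ω → ℝ} {r s : ℝ} (hs : 1 ≤ s)
    (hsr : s ≤ r) (hf : MemHeart r μ f) : MemHeart s μ f := by
  have hfm := hf.aemeasurable
  refine (memHeart_iff hs).2 ⟨hfm, fun c hc => ?_⟩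
  refine ((((memHeart_iff (hs.trans hsr)).1 hf).2 c hc).const_mul (Real.exp 1)).mono'
    (aemeasurable_exp_rpow hfm s c).aestronglyMeasurable (ae_of_all _ fun ω => ?_)
  rw [Real.norm_eq_abs, Real.abs_exp, ← Real.exp_add, Real.exp_le_exp]
  have hx : 0 ≤ |f ω| / c := by positivity
  rcases le_total (|f ω| / c) 1 with h | h
  · have := Real.rpow_le_one hx h (by linarith : 0 ≤ s)
    have := Real.rpow_nonneg hx r
    linarith
  · have := Real.rpow_le_rpow_of_exponent_le h hsr
    linarith

theorem memHeart_const [IsProbabilityMeasure μ] {r : ℝ} (hr : 1 ≤ r) (a : ℝ) :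
    MemHeart r μ fun _ => a :=
  (memHeart_iff hr).2 ⟨aemeasurable_const, fun _ _ => integrable_const _⟩

theorem MemHeart.const_mul [IsProbabilityMeasure μ] {f : Ω → ℝ} {r : ℝ} (hr : 1 ≤ r)
    (hf : MemHeart r μ f) (a : ℝ) : MemHeart r μ fun ω => a * f ω := by
  rcases eq_or_ne a 0 with rfl | ha
  · simpa using memHeart_const hr 0
  · refine (memHeart_iff hr).2 ⟨hf.aemeasurable.const_mul a, fun c hc => ?_⟩
    have ha' := abs_pos.2 ha
    refine (((memHeart_iff hr).1 hf).2 (c / |a|) (by positivity)).congr (ae_of_all _ fun ω => ?_)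
    simp only [abs_mul]
    congr 2
    field_simp

theorem MemHeart.neg [IsProbabilityMeasure μ] {f : Ω → ℝ} {r : ℝ} (hr : 1 ≤ r)
    (hf : MemHeart r μ f) : MemHeart r μ fun ω => -f ω := by
  simpa using hf.const_mul hr (-1)

theorem MemHeart.abs [IsProbabilityMeasure μ] {f : Ω → ℝ} {r : ℝ} (hr : 1 ≤ r)
    (hf : MemHeart r μ f) : MemHeart r μ fun ω => |f ω| :=
  hf.mono hr (continuous_abs.measurable.comp_aemeasurable hf.aemeasurable) (by simp)

theorem MemHeart.add [IsProbabilityMeasure μ] {f g : Ω → ℝ}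
    (hf : MemHeart 1 μ f) (hg : MemHeart 1 μ g) : MemHeart 1 μ fun ω => f ω + g ω := by
  have hm : AEMeasurable (fun ω => f ω + g ω) μ := hf.aemeasurable.add hg.aemeasurable
  refine memHeart_of_forall_ge hm fun t ht => ?_
  refine ((hf.integrable_exp_mul_abs (2 * t)).add (hg.integrable_exp_mul_abs (2 * t))).mono'
    (Real.measurable_exp.comp_aemeasurable
        ((continuous_abs.measurable.comp_aemeasurable hm).const_mul t)).aestronglyMeasurable
    (ae_of_all _ fun ω => ?_)
  rw [Real.norm_eq_abs, Real.abs_exp, Pi.add_apply]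
  have h0 := abs_add_le (f ω) (g ω)
  rcases le_total |f ω| |g ω| with h | h
  · have : Real.exp (t * |f ω + g ω|) ≤ Real.exp (2 * t * |g ω|) :=
      Real.exp_le_exp.2 (by nlinarith)
    linarith [Real.exp_pos (2 * t * |f ω|)]
  · have : Real.exp (t * |f ω + g ω|) ≤ Real.exp (2 * t * |f ω|) :=
      Real.exp_le_exp.2 (by nlinarith)
    linarith [Real.exp_pos (2 * t * |g ω|)]

theorem MemHeart.sub [IsProbabilityMeasure μ] {f g : Ω → ℝ}
    (hf : MemHeart 1 μ f) (hg : MemHeart 1 μ g) : MemHeart 1 μ fun ω => f ω - g ω := by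
  simpa [sub_eq_add_neg] using hf.add (hg.neg le_rfl)

theorem MemHeart.comp_of_map {Ω' : Type*} [MeasurableSpace Ω'] {ν : Measure Ω'}
    [IsProbabilityMeasure μ] [IsProbabilityMeasure ν] {f : Ω → ℝ} {π : Ω' → Ω}
    (hπ : MeasurePreserving π ν μ) {r : ℝ} (hr : 1 ≤ r) (hf : MemHeart r μ f) :
    MemHeart r ν fun ω => f (π ω) := by
  obtain ⟨hm, hi⟩ := (memHeart_iff hr).1 hf
  refine (memHeart_iff hr).2
    ⟨hm.comp_quasiMeasurePreserving hπ.quasiMeasurePreserving, fun c hc => ?_⟩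
  exact (hπ.integrable_comp (hi c hc).aestronglyMeasurable).2 (hi c hc)

end Heart

/-! ### Gibbs and Jensen inequalities for a single probability law -/

section Pointwise

variable {Ω : Type*} [MeasurableSpace Ω] {μ : Measure Ω}

/-- Gibbs variational inequality: apply `t + 1 ≤ exp t` at `t = g - log A` and average with weight
`m`. -/
theorem integral_mul_le_log_integral {m g F : Ω → ℝ} (hm : ∀ ω, 0 ≤ m ω) (hmi : Integrable m μ)
    (hm1 : ∫ ω, m ω ∂μ = 1) (hmg : Integrable (fun ω => m ω * g ω) μ) (hF : Integrable F μ)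
    (hF0 : 0 < ∫ ω, F ω ∂μ) (h : ∀ ω, m ω * Real.exp (g ω) ≤ F ω) :
    ∫ ω, m ω * g ω ∂μ ≤ Real.log (∫ ω, F ω ∂μ) := by
  set A := ∫ ω, F ω ∂μ
  have h1 : ∫ ω, (m ω * g ω + m ω * (1 - Real.log A)) ∂μ ≤ ∫ ω, F ω / A ∂μ := by
    refine integral_mono (hmg.add (hmi.mul_const _)) (hF.div_const A) fun ω => ?_
    have h2 := Real.add_one_le_exp (g ω - Real.log A)
    rw [Real.exp_sub, Real.exp_log hF0] at h2
    calc m ω * g ω + m ω * (1 - Real.log A) = m ω * (g ω - Real.log A + 1) := by ring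
      _ ≤ m ω * (Real.exp (g ω) / A) := by gcongr; exact hm ω
      _ = m ω * Real.exp (g ω) / A := by ring
      _ ≤ F ω / A := by gcongr; exact h ω
  rw [integral_add hmg (hmi.mul_const _), integral_mul_const, hm1, integral_div,
    div_self hF0.ne'] at h1
  linarith

variable [IsProbabilityMeasure μ]

theorem integral_le_log_integral_exp {F : Ω → ℝ} (hF : MemHeart 1 μ F) :
    ∫ ω, F ω ∂μ ≤ Real.log (∫ ω, Real.exp (F ω) ∂μ) := by
  have := integral_mul_le_log_integral (μ := μ) (m := fun _ => 1) (g := F)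
    (F := fun ω => Real.exp (F ω)) (by simp) (integrable_const 1) (by simp)
    (by simpa using hF.integrable) hF.integrable_exp (integral_exp_pos hF.integrable_exp) (by simp)
  simpa using this

theorem log_integral_exp_mono {F G : Ω → ℝ} (hF : MemHeart 1 μ F) (hG : MemHeart 1 μ G)
    (h : ∀ᵐ ω ∂μ, F ω ≤ G ω) :
    Real.log (∫ ω, Real.exp (F ω) ∂μ) ≤ Real.log (∫ ω, Real.exp (G ω) ∂μ) :=
  Real.log_le_log (integral_exp_pos hF.integrable_exp)
    (integral_mono_ae hF.integrable_exp hG.integrable_exp (h.mono fun _ hω => Real.exp_le_exp.2 hω))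

theorem neg_log_integral_exp_neg_le {F : Ω → ℝ} (hF : MemHeart 1 μ F) :
    -Real.log (∫ ω, Real.exp (-F ω) ∂μ) ≤ Real.log (∫ ω, Real.exp (F ω) ∂μ) := by
  have h1 := integral_le_log_integral_exp hF
  have h2 := integral_le_log_integral_exp (hF.neg le_rfl)
  rw [integral_neg] at h2
  linarith

/-- Monotonicity of `L^t` norms of `exp F`, obtained after normalization from convexity of `exp`
between `t F - log A` and `0`. -/
theorem mul_log_integral_exp_le {F : Ω → ℝ} (hF : MemHeart 1 μ F) {t : ℝ} (ht : 1 ≤ t) :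
    t * Real.log (∫ ω, Real.exp (F ω) ∂μ) ≤ Real.log (∫ ω, Real.exp (t * F ω) ∂μ) := by
  have hi := (hF.const_mul le_rfl t).integrable_exp
  have hA := integral_exp_pos hi
  set A := ∫ ω, Real.exp (t * F ω) ∂μ
  have ht0 : 0 < t := by linarith
  have h1 : ∫ ω, Real.exp (F ω) * Real.exp (-(Real.log A / t)) ∂μ
      ≤ ∫ ω, (Real.exp (t * F ω) / A * (1 / t) + (1 - 1 / t)) ∂μ := by
    refine integral_mono (hF.integrable_exp.mul_const _)
      (((hi.div_const A).mul_const _).add (integrable_const _)) fun ω => ?_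
    have h2 := convexOn_exp.2 (Set.mem_univ (t * F ω - Real.log A)) (Set.mem_univ 0)
      (show 0 ≤ 1 / t by positivity) (show 0 ≤ 1 - 1 / t by
        rw [sub_nonneg, div_le_one ht0]; exact ht) (by ring)
    simp only [smul_eq_mul, mul_zero, add_zero, Real.exp_zero, mul_one] at h2
    rw [Real.exp_sub, Real.exp_log hA] at h2
    rw [← Real.exp_add]
    calc Real.exp (F ω + -(Real.log A / t)) = Real.exp (1 / t * (t * F ω - Real.log A)) := by
          congr 1; field_simp; ring
      _ ≤ _ := by linarith
  rw [integral_mul_const, integral_add ((hi.div_const A).mul_const _) (integrable_const _),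
    integral_mul_const, integral_div, div_self hA.ne'] at h1
  simp only [integral_const, probReal_univ, smul_eq_mul, one_mul] at h1
  have h3 : ∫ ω, Real.exp (F ω) ∂μ ≤ Real.exp (Real.log A / t) := by
    rw [Real.exp_neg, ← div_eq_mul_inv, div_le_iff₀ (Real.exp_pos _)] at h1
    linarith
  have h4 := Real.log_le_log (integral_exp_pos hF.integrable_exp) h3
  rw [Real.log_exp, le_div_iff₀ ht0] at h4
  linarith

theorem exp_mul_abs_log_integral_exp_le {F : Ω → ℝ} (hF : MemHeart 1 μ F) {t : ℝ} (ht : 1 ≤ t) :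
    Real.exp (t * |Real.log (∫ ω, Real.exp (F ω) ∂μ)|) ≤ ∫ ω, Real.exp (t * |F ω|) ∂μ := by
  have ha := hF.abs le_rfl
  have h1 := log_integral_exp_mono hF ha (ae_of_all _ fun ω => le_abs_self _)
  have h2 := log_integral_exp_mono (hF.neg le_rfl) ha (ae_of_all _ fun ω => neg_le_abs _)
  have h3 := neg_log_integral_exp_neg_le hF
  have h4 := mul_log_integral_exp_le ha ht
  rw [← Real.exp_log (integral_exp_pos (hF.integrable_exp_mul_abs t)), Real.exp_le_exp]
  refine le_trans ?_ h4
  gcongr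
  exact abs_le.2 ⟨by linarith, h1⟩

theorem MemHeart.integrable_exp_mul {k f : Ω → ℝ} (hk : MemHeart 1 μ k) (hf : MemHeart 1 μ f) :
    Integrable (fun ω => Real.exp (k ω) * f ω) μ := by
  refine (hk.add (hf.abs le_rfl)).integrable_exp.mono'
    ((Real.measurable_exp.comp_aemeasurable hk.aemeasurable).mul
      hf.aemeasurable).aestronglyMeasurable (ae_of_all _ fun ω => ?_)
  rw [Real.norm_eq_abs, abs_mul, Real.abs_exp, Real.exp_add]
  gcongr
  linarith [Real.add_one_le_exp |f ω|]

theorem integral_exp_mul_le_log {k g : Ω → ℝ} (hk : MemHeart 1 μ k) (hg : MemHeart 1 μ g)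
    (hk1 : ∫ ω, Real.exp (k ω) ∂μ = 1) :
    ∫ ω, Real.exp (k ω) * g ω ∂μ ≤ Real.log (∫ ω, Real.exp (k ω + g ω) ∂μ) :=
  integral_mul_le_log_integral (fun _ => (Real.exp_pos _).le) hk.integrable_exp hk1
    (hk.integrable_exp_mul hg) (hk.add hg).integrable_exp
    (integral_exp_pos (hk.add hg).integrable_exp) fun ω => by rw [Real.exp_add]

/-- Split `|f| = (|f| - k) + k` and apply the Gibbs inequality to each summand: in the first `k`
cancels, in the second it doubles. The coefficient of `log E e^{|f|}` is exactly one, which the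
contraction later needs. -/
theorem abs_integral_exp_mul_le {k f : Ω → ℝ} (hk : MemHeart 1 μ k) (hf : MemHeart 1 μ f)
    (hk1 : ∫ ω, Real.exp (k ω) ∂μ = 1) :
    |∫ ω, Real.exp (k ω) * f ω ∂μ| ≤
      Real.log (∫ ω, Real.exp (2 * k ω) ∂μ) + Real.log (∫ ω, Real.exp |f ω| ∂μ) := by
  have hfa := hf.abs le_rfl
  have h1 := integral_exp_mul_le_log hk hk hk1
  have h2 := integral_exp_mul_le_log hk (hfa.sub hk) hk1
  have h3 : |∫ ω, Real.exp (k ω) * f ω ∂μ| ≤ ∫ ω, Real.exp (k ω) * |f ω| ∂μ := by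
    refine (abs_integral_le_integral_abs).trans_eq ?_
    simp [abs_mul]
  have h4 : ∫ ω, Real.exp (k ω) * |f ω| ∂μ =
      ∫ ω, Real.exp (k ω) * (|f ω| - k ω) ∂μ + ∫ ω, Real.exp (k ω) * k ω ∂μ := by
    rw [← integral_add (hk.integrable_exp_mul (hfa.sub hk)) (hk.integrable_exp_mul hk)]
    congr 1 with ω
    ring
  simp only [add_sub_cancel] at h2
  simp only [← two_mul] at h1
  linarith

/-- Subgradient inequality for the convex functional `log E exp`: the Gibbs inequality for the law
tilted by `F`, tested on `G - F`. -/
theorem log_integral_exp_sub_le {F G : Ω → ℝ} (hF : MemHeart 1 μ F) (hG : MemHeart 1 μ G) :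
    Real.log (∫ ω, Real.exp (F ω) ∂μ) - Real.log (∫ ω, Real.exp (G ω) ∂μ) ≤
      ∫ ω, Real.exp (F ω - Real.log (∫ ω, Real.exp (F ω) ∂μ)) * (F ω - G ω) ∂μ := by
  have hA := integral_exp_pos hF.integrable_exp
  set A := ∫ ω, Real.exp (F ω) ∂μ
  have hk : MemHeart 1 μ fun ω => F ω - Real.log A := hF.sub (memHeart_const le_rfl _)
  have hk1 : ∫ ω, Real.exp (F ω - Real.log A) ∂μ = 1 := by
    simp only [Real.exp_sub, Real.exp_log hA]
    rw [integral_div, div_self hA.ne']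
  have h := integral_exp_mul_le_log hk (hG.sub hF) hk1
  have h2 : ∀ ω, F ω - Real.log A + (G ω - F ω) = G ω - Real.log A := fun ω => by ring
  simp only [h2, Real.exp_sub, Real.exp_log hA] at h
  rw [integral_div, Real.log_div (integral_exp_pos hG.integrable_exp).ne' hA.ne'] at h
  have h3 : ∫ ω, Real.exp (F ω - Real.log A) * (F ω - G ω) ∂μ
      = -∫ ω, Real.exp (F ω) / A * (G ω - F ω) ∂μ := by
    rw [← integral_neg]
    congr 1 with ω
    rw [Real.exp_sub, Real.exp_log hA]
    ring
  linarith

end Pointwise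

/-! ### Disintegration along the kernel and the entropic operator -/

section Kernel

variable {X : Type*} [MeasurableSpace X] {Q₀ : Measure X} {Q : Kernel X X}

theorem ae_ae_of_ae_invariant (hQ : Kernel.Invariant Q Q₀) {p : X → Prop} (h : ∀ᵐ y ∂Q₀, p y) :
    ∀ᵐ x ∂Q₀, ∀ᵐ y ∂Q x, p y :=
  Measure.ae_ae_of_ae_bind Q.aemeasurable (by rwa [hQ])

variable [IsProbabilityMeasure Q₀] [IsMarkovKernel Q]

theorem measurePreserving_fst_compProd : MeasurePreserving Prod.fst (Q₀ ⊗ₘ Q) Q₀ :=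
  ⟨measurable_fst, Measure.fst_compProd Q₀ Q⟩

theorem measurePreserving_snd_compProd (hQ : Kernel.Invariant Q Q₀) :
    MeasurePreserving Prod.snd (Q₀ ⊗ₘ Q) Q₀ :=
  ⟨measurable_snd, (Measure.snd_compProd Q₀ Q).trans hQ⟩

theorem MemHeart.comp_fst {r : ℝ} (hr : 1 ≤ r) {f : X → ℝ} (hf : MemHeart r Q₀ f) :
    MemHeart r (Q₀ ⊗ₘ Q) fun p => f p.1 :=
  hf.comp_of_map measurePreserving_fst_compProd hr

theorem MemHeart.comp_snd (hQ : Kernel.Invariant Q Q₀) {r : ℝ} (hr : 1 ≤ r) {f : X → ℝ}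
    (hf : MemHeart r Q₀ f) : MemHeart r (Q₀ ⊗ₘ Q) fun p => f p.2 :=
  hf.comp_of_map (measurePreserving_snd_compProd hQ) hr

theorem integrable_of_integrable_compProd {F : X × X → ℝ} (hF : Integrable F (Q₀ ⊗ₘ Q)) :
    Integrable (fun x => ∫ y, F (x, y) ∂Q x) Q₀ := by
  have := Integrable.integral_compProd (κ := Kernel.const Unit Q₀) (η := Kernel.prodMkLeft Unit Q)
    (a := ()) hF
  simpa using this

theorem ae_integrable_of_integrable_compProd {F : X × X → ℝ} (hF : Integrable F (Q₀ ⊗ₘ Q)) :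
    ∀ᵐ x ∂Q₀, Integrable (fun y => F (x, y)) (Q x) :=
  ((Measure.integrable_compProd_iff hF.aestronglyMeasurable).1 hF).1

theorem integral_integral_of_invariant (hQ : Kernel.Invariant Q Q₀) {f : X → ℝ}
    (hf : Integrable f Q₀) : ∫ x, ∫ y, f y ∂Q x ∂Q₀ = ∫ x, f x ∂Q₀ := by
  have hp := measurePreserving_snd_compProd hQ
  have h1 : Integrable (fun p : X × X => f p.2) (Q₀ ⊗ₘ Q) :=
    (hp.integrable_comp hf.aestronglyMeasurable).2 hf
  have h2 := Measure.integral_compProd h1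
  have h3 := integral_map (μ := Q₀ ⊗ₘ Q) (φ := Prod.snd) (f := f) measurable_snd.aemeasurable
    (by rw [hp.map_eq]; exact hf.aestronglyMeasurable)
  rw [hp.map_eq] at h3
  rw [← h2, h3]

theorem MemHeart.ae_section {F : X × X → ℝ} (hF : MemHeart 1 (Q₀ ⊗ₘ Q) F) :
    ∀ᵐ x ∂Q₀, MemHeart 1 (Q x) fun y => F (x, y) := by
  have h1 : ∀ᵐ x ∂Q₀, AEStronglyMeasurable (fun y => F (x, y)) (Q x) :=
    AEStronglyMeasurable.ae_of_compProd (f := fun x y => F (x, y))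
      hF.aemeasurable.aestronglyMeasurable
  -- Natural exponents suffice, so only countably many null sets are discarded.
  have h2 : ∀ᵐ x ∂Q₀, ∀ n : ℕ, Integrable (fun y => Real.exp (n * |F (x, y)|)) (Q x) :=
    ae_all_iff.2 fun n => ae_integrable_of_integrable_compProd (hF.integrable_exp_mul_abs n)
  filter_upwards [h1, h2] with x hx1 hx2
  refine memHeart_one_iff.2 ⟨hx1.aemeasurable, fun t => ?_⟩
  obtain ⟨n, hn⟩ := exists_nat_ge t
  refine (hx2 n).mono' (Real.measurable_exp.comp_aemeasurable
    ((continuous_abs.measurable.comp_aemeasurable hx1.aemeasurable).const_mul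
      t)).aestronglyMeasurable (ae_of_all _ fun ω => ?_)
  rw [Real.norm_eq_abs, Real.abs_exp]
  gcongr

/-- The entropic conditional expectation `log E^Q[exp F(X_t, X_{t+1}) | X_t = x]`. -/
def entropic (Q : Kernel X X) (F : X × X → ℝ) (x : X) : ℝ :=
  Real.log (∫ y, Real.exp (F (x, y)) ∂Q x)

theorem MemHeart.entropic {F : X × X → ℝ} (hF : MemHeart 1 (Q₀ ⊗ₘ Q) F) :
    MemHeart 1 Q₀ (entropic Q F) := by
  have hm : AEMeasurable (RobustValue.entropic Q F) Q₀ :=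
    Real.measurable_log.comp_aemeasurable
      (integrable_of_integrable_compProd hF.integrable_exp).aemeasurable
  refine memHeart_of_forall_ge hm fun t ht => ?_
  refine (integrable_of_integrable_compProd (hF.integrable_exp_mul_abs t)).mono'
    (Real.measurable_exp.comp_aemeasurable
      ((continuous_abs.measurable.comp_aemeasurable hm).const_mul t)).aestronglyMeasurable ?_
  filter_upwards [hF.ae_section] with x hx
  rw [Real.norm_eq_abs, Real.abs_exp]
  exact exp_mul_abs_log_integral_exp_le hx ht

theorem entropic_mono {F G : X × X → ℝ} (hF : MemHeart 1 (Q₀ ⊗ₘ Q) F)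
    (hG : MemHeart 1 (Q₀ ⊗ₘ Q) G) (h : ∀ᵐ p ∂(Q₀ ⊗ₘ Q), F p ≤ G p) :
    entropic Q F ≤ᵐ[Q₀] entropic Q G := by
  filter_upwards [hF.ae_section, hG.ae_section, Measure.ae_ae_of_ae_compProd h] with x h1 h2 h3
  exact log_integral_exp_mono h1 h2 h3

theorem neg_entropic_neg_le {F : X × X → ℝ} (hF : MemHeart 1 (Q₀ ⊗ₘ Q) F) :
    ∀ᵐ x ∂Q₀, -entropic Q (fun p => -F p) x ≤ entropic Q F x := by
  filter_upwards [hF.ae_section] with x h1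
  exact neg_log_integral_exp_neg_le h1

end Kernel

/-! ### Operator norms and existence of the spectral radius -/

section OperatorNorm

theorem iterate_homogeneous {Y : Type*} {K : (Y → ℝ) → Y → ℝ}
    (hK : ∀ (a : ℝ) (f : Y → ℝ), K (fun x => a * f x) = fun x => a * K f x)
    (n : ℕ) (a : ℝ) (f : Y → ℝ) : K^[n] (fun x => a * f x) = fun x => a * K^[n] f x := by
  induction n generalizing f with
  | zero => rfl
  | succ n ih => rw [Function.iterate_succ_apply, hK, ih, Function.iterate_succ_apply]

variable {Ω : Type*} [MeasurableSpace Ω] {μ : Measure Ω}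

theorem luxNorm_le_heartOpNorm_mul [IsProbabilityMeasure μ] {K : (Ω → ℝ) → Ω → ℝ}
    (hK : ∀ (a : ℝ) (f : Ω → ℝ), K (fun ω => a * f ω) = fun ω => a * K f ω)
    (hfin : heartOpNorm 1 μ K < ∞) {f : Ω → ℝ} (hf : MemHeart 1 μ f) :
    luxNorm 1 μ (K f) ≤ heartOpNorm 1 μ K * luxNorm 1 μ f := by
  have key : ∀ c : ℝ, 0 < c → modular 1 μ f c ≤ 1 →
      luxNorm 1 μ (K f) ≤ heartOpNorm 1 μ K * ENNReal.ofReal c := by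
    intro c hc hm
    have h1 : luxNorm 1 μ (fun ω => c⁻¹ * f ω) ≤ 1 := by
      rw [luxNorm_const_mul (inv_pos.2 hc)]
      refine (mul_le_mul_right (luxNorm_le hc hm) _).trans ?_
      rw [← ENNReal.ofReal_mul (by positivity), inv_mul_cancel₀ hc.ne', ENNReal.ofReal_one]
    have h2 : luxNorm 1 μ (K fun ω => c⁻¹ * f ω) ≤ heartOpNorm 1 μ K :=
      le_iSup_of_le _ <| le_iSup_of_le (hf.const_mul le_rfl c⁻¹) <| le_iSup_of_le h1 le_rfl
    rw [hK, luxNorm_const_mul (inv_pos.2 hc), ENNReal.ofReal_inv_of_pos hc,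
      ENNReal.inv_mul_le_iff (by simpa using hc) ENNReal.ofReal_ne_top] at h2
    rwa [mul_comm] at h2
  -- Multiplication passes through the infimum only for a nonzero factor; a zero norm needs just one
  -- admissible scale.
  rcases eq_or_ne (heartOpNorm 1 μ K) 0 with h0 | h0
  · have h1 := hf.1.2
    simp only [luxNorm, iInf_lt_iff] at h1
    obtain ⟨c, hc, hm, -⟩ := h1
    have := key c hc hm
    simpa [h0] using this
  · conv_rhs => rw [luxNorm]
    rw [ENNReal.mul_iInf_of_ne h0 hfin.ne]
    refine le_iInf fun c => ?_
    rw [ENNReal.mul_iInf_of_ne h0 hfin.ne]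
    refine le_iInf fun hc => ?_
    rw [ENNReal.mul_iInf_of_ne h0 hfin.ne]
    exact le_iInf fun h => key c hc h

theorem heartOpNorm_comp_le [IsProbabilityMeasure μ] {K L : (Ω → ℝ) → Ω → ℝ}
    (hK : ∀ (a : ℝ) (f : Ω → ℝ), K (fun ω => a * f ω) = fun ω => a * K f ω)
    (hfin : heartOpNorm 1 μ K < ∞) (hL : ∀ f, MemHeart 1 μ f → MemHeart 1 μ (L f)) :
    heartOpNorm 1 μ (K ∘ L) ≤ heartOpNorm 1 μ K * heartOpNorm 1 μ L := by
  refine iSup_le fun f => iSup_le fun hf => iSup_le fun h1 => ?_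
  refine (luxNorm_le_heartOpNorm_mul hK hfin (hL f hf)).trans ?_
  gcongr
  exact le_iSup_of_le f <| le_iSup_of_le hf <| le_iSup_of_le h1 le_rfl

theorem one_le_luxNorm_one [IsProbabilityMeasure μ] : 1 ≤ luxNorm 1 μ fun _ => (1 : ℝ) := by
  refine le_iInf fun c => le_iInf fun hc => le_iInf fun h => ?_
  simp only [modular, phi, abs_one, Real.rpow_one, lintegral_const, measure_univ, mul_one,
    ENNReal.ofReal_le_one] at h
  have h1 := Real.add_one_le_exp (1 / c)
  have h2 : 1 / c ≤ 1 := by linarith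
  rw [div_le_one hc] at h2
  simpa using h2

/-- Fekete's lemma for `log a n`; the geometric lower bound keeps the logarithms finite and `log (a
n) / n` bounded below. -/
theorem tendsto_rpow_one_div_of_submultiplicative {a : ℕ → ℝ≥0∞} {b : ℝ} (hb : 0 < b)
    (hfin : ∀ n, a n ≠ ∞) (hlow : ∀ n, ENNReal.ofReal (b ^ n) ≤ a n)
    (hsub : ∀ m n, a (m + n) ≤ a m * a n) :
    ∃ l, Tendsto (fun n : ℕ => a n ^ (1 / (n : ℝ))) atTop (𝓝 l) := by
  have hle : ∀ n, b ^ n ≤ (a n).toReal := fun n => by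
    rw [← ENNReal.toReal_ofReal (pow_pos hb n).le]
    exact ENNReal.toReal_mono (hfin n) (hlow n)
  have hpos : ∀ n, 0 < (a n).toReal := fun n => (pow_pos hb n).trans_le (hle n)
  have hS : Subadditive fun n => Real.log (a n).toReal := by
    intro m n
    rw [← Real.log_mul (hpos m).ne' (hpos n).ne', ← ENNReal.toReal_mul]
    exact Real.log_le_log (hpos _)
      (ENNReal.toReal_mono (ENNReal.mul_ne_top (hfin m) (hfin n)) (hsub m n))
  have hB : BddBelow (Set.range fun n : ℕ => Real.log (a n).toReal / n) := by
    -- The `0` covers the index `n = 0`, where division by zero returns `0`.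
    refine ⟨min 0 (Real.log b), ?_⟩
    rintro _ ⟨n, rfl⟩
    rcases Nat.eq_zero_or_pos n with rfl | hn
    · simp
    · have hn' : (0 : ℝ) < n := by exact_mod_cast hn
      refine (min_le_right _ _).trans ?_
      rw [le_div_iff₀ hn']
      have := Real.log_le_log (pow_pos hb n) (hle n)
      rw [Real.log_pow] at this
      linarith
  refine ⟨_, (ENNReal.tendsto_ofReal
    ((Real.continuous_exp.tendsto _).comp (hS.tendsto_lim hB))).congr' ?_⟩
  filter_upwards [eventually_gt_atTop 0] with n hn
  have hn' : (0 : ℝ) < n := by exact_mod_cast hn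
  simp only [Function.comp_apply]
  rw [← ENNReal.ofReal_toReal (hfin n), ENNReal.ofReal_rpow_of_pos (hpos n),
    Real.rpow_def_of_pos (hpos n), ENNReal.toReal_ofReal (hpos n).le, mul_one_div]

end OperatorNorm

/-! ### Tilted conditional expectations, stability and comparison of fixed points -/

section Tilt

variable {X : Type*} [MeasurableSpace X]

theorem T_eq_entropic (Q : Kernel X X) (u : X × X → ℝ) (β θ : ℝ) (f : X → ℝ) :
    T Q u β θ f = fun x => β * entropic Q (fun p => f p.2 + alpha β θ * u p) x := rfl

/-- The conditional expectation under the worst-case belief, so that `D_w = β E^{m_w}`. -/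
def tilt (Q : Kernel X X) (u : X × X → ℝ) (β θ : ℝ) (w f : X → ℝ) (x : X) : ℝ :=
  ∫ y, distortion Q u β θ w x y * f y ∂Q x

theorem tilt_const_mul (Q : Kernel X X) (u : X × X → ℝ) (β θ : ℝ) (w : X → ℝ) (a : ℝ)
    (f : X → ℝ) :
    tilt Q u β θ w (fun x => a * f x) = fun x => a * tilt Q u β θ w f x := by
  ext x
  simp only [tilt]
  rw [← integral_const_mul]
  congr 1 with y
  ring

theorem iterate_const_mul_tilt (Q : Kernel X X) (u : X × X → ℝ) (β θ : ℝ) (w : X → ℝ) (b : ℝ)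
    (n : ℕ) (f : X → ℝ) :
    (fun g x => b * tilt Q u β θ w g x)^[n] f = fun x => b ^ n * (tilt Q u β θ w)^[n] f x := by
  induction n with
  | zero => simp
  | succ n ih =>
    rw [Function.iterate_succ_apply', ih, Function.iterate_succ_apply', tilt_const_mul]
    ext x
    ring

theorem D_eq_tilt (Q : Kernel X X) (u : X × X → ℝ) (β θ : ℝ) (w : X → ℝ) :
    D Q u β θ w = fun g x => β * tilt Q u β θ w g x := rfl

theorem D_const_mul (Q : Kernel X X) (u : X × X → ℝ) (β θ : ℝ) (w : X → ℝ) (a : ℝ)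
    (f : X → ℝ) :
    D Q u β θ w (fun x => a * f x) = fun x => a * D Q u β θ w f x := by
  simp only [D_eq_tilt, tilt_const_mul]
  ext x
  ring

/-- The logarithm of the belief distortion `m_w`. -/
def logDistortion (Q : Kernel X X) (u : X × X → ℝ) (β θ : ℝ) (w : X → ℝ) (p : X × X) : ℝ :=
  w p.2 + alpha β θ * u p - entropic Q (fun p => w p.2 + alpha β θ * u p) p.1

variable {Q₀ : Measure X} {Q : Kernel X X} {u : X × X → ℝ} {β θ : ℝ} {w : X → ℝ}

theorem tilt_congr (hQ : Kernel.Invariant Q Q₀) {f g : X → ℝ} (h : f =ᵐ[Q₀] g) :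
    tilt Q u β θ w f =ᵐ[Q₀] tilt Q u β θ w g := by
  filter_upwards [ae_ae_of_ae_invariant hQ h] with x hx
  exact integral_congr_ae (hx.mono fun y hy => by simp only [hy])

variable [IsProbabilityMeasure Q₀] [IsMarkovKernel Q]

theorem memHeart_exponent (hQ : Kernel.Invariant Q Q₀) (hu : MemHeart 1 (Q₀ ⊗ₘ Q) u)
    (hw : MemHeart 1 Q₀ w) : MemHeart 1 (Q₀ ⊗ₘ Q) fun p => w p.2 + alpha β θ * u p :=
  (hw.comp_snd hQ le_rfl).add (hu.const_mul le_rfl _)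

theorem memHeart_T (hQ : Kernel.Invariant Q Q₀) (hu : MemHeart 1 (Q₀ ⊗ₘ Q) u)
    (hw : MemHeart 1 Q₀ w) : MemHeart 1 Q₀ (T Q u β θ w) :=
  (memHeart_exponent hQ hu hw).entropic.const_mul le_rfl β

theorem T_mono (hQ : Kernel.Invariant Q Q₀) (hu : MemHeart 1 (Q₀ ⊗ₘ Q) u) (hβ : 0 ≤ β)
    {f g : X → ℝ} (hf : MemHeart 1 Q₀ f) (hg : MemHeart 1 Q₀ g) (h : f ≤ᵐ[Q₀] g) :
    T Q u β θ f ≤ᵐ[Q₀] T Q u β θ g := by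
  have h' : ∀ᵐ p ∂(Q₀ ⊗ₘ Q), f p.2 ≤ g p.2 :=
    (measurePreserving_snd_compProd hQ).quasiMeasurePreserving.ae h
  filter_upwards [entropic_mono (memHeart_exponent (β := β) (θ := θ) hQ hu hf)
    (memHeart_exponent hQ hu hg) (h'.mono fun p hp => add_le_add_left hp _)] with x hx
  exact mul_le_mul_of_nonneg_left hx hβ

theorem memHeart_logDistortion (hQ : Kernel.Invariant Q Q₀) (hu : MemHeart 1 (Q₀ ⊗ₘ Q) u)
    (hw : MemHeart 1 Q₀ w) : MemHeart 1 (Q₀ ⊗ₘ Q) (logDistortion Q u β θ w) :=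
  (memHeart_exponent hQ hu hw).sub ((memHeart_exponent hQ hu hw).entropic.comp_fst le_rfl)

theorem ae_distortion_eq (hQ : Kernel.Invariant Q Q₀) (hu : MemHeart 1 (Q₀ ⊗ₘ Q) u)
    (hw : MemHeart 1 Q₀ w) :
    ∀ᵐ x ∂Q₀, (∀ y, distortion Q u β θ w x y = Real.exp (logDistortion Q u β θ w (x, y))) ∧
      ∫ y, Real.exp (logDistortion Q u β θ w (x, y)) ∂Q x = 1 := by
  filter_upwards [(memHeart_exponent (β := β) (θ := θ) hQ hu hw).ae_section] with x hx
  have hA := integral_exp_pos hx.integrable_exp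
  have h1 : ∀ y, distortion Q u β θ w x y = Real.exp (logDistortion Q u β θ w (x, y)) := by
    intro y
    simp only [logDistortion, entropic, Real.exp_sub]
    rw [Real.exp_log hA]
    rfl
  refine ⟨h1, ?_⟩
  simp only [← h1, distortion, condExpExp]
  rw [integral_div, div_self hA.ne']

theorem ae_abs_tilt_le (hQ : Kernel.Invariant Q Q₀) (hu : MemHeart 1 (Q₀ ⊗ₘ Q) u)
    (hw : MemHeart 1 Q₀ w) {f : X → ℝ} (hf : MemHeart 1 Q₀ f) :
    ∀ᵐ x ∂Q₀, |tilt Q u β θ w f x| ≤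
      entropic Q (fun p => 2 * logDistortion Q u β θ w p) x + entropic Q (fun p => |f p.2|) x := by
  filter_upwards [ae_distortion_eq (β := β) (θ := θ) hQ hu hw,
    (memHeart_logDistortion (β := β) (θ := θ) hQ hu hw).ae_section,
    (hf.comp_snd (Q := Q) hQ le_rfl).ae_section] with x h1 h2 h3
  simp only [tilt, h1.1]
  exact abs_integral_exp_mul_le h2 h3 h1.2

theorem aemeasurable_tilt (hQ : Kernel.Invariant Q Q₀) (hu : MemHeart 1 (Q₀ ⊗ₘ Q) u)
    (hw : MemHeart 1 Q₀ w) {f : X → ℝ} (hf : MemHeart 1 Q₀ f) :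
    AEMeasurable (tilt Q u β θ w f) Q₀ := by
  refine (integrable_of_integrable_compProd ((memHeart_logDistortion (β := β) (θ := θ) hQ hu
    hw).integrable_exp_mul (hf.comp_snd (Q := Q) hQ le_rfl))).aemeasurable.congr ?_
  filter_upwards [ae_distortion_eq (β := β) (θ := θ) hQ hu hw] with x h1
  simp only [tilt, h1.1]

theorem tilt_mono (hQ : Kernel.Invariant Q Q₀) (hu : MemHeart 1 (Q₀ ⊗ₘ Q) u)
    (hw : MemHeart 1 Q₀ w) {f g : X → ℝ} (hf : MemHeart 1 Q₀ f) (hg : MemHeart 1 Q₀ g)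
    (h : f ≤ᵐ[Q₀] g) : tilt Q u β θ w f ≤ᵐ[Q₀] tilt Q u β θ w g := by
  filter_upwards [ae_distortion_eq (β := β) (θ := θ) hQ hu hw,
    (memHeart_logDistortion (β := β) (θ := θ) hQ hu hw).ae_section,
    (hf.comp_snd (Q := Q) hQ le_rfl).ae_section,
    (hg.comp_snd (Q := Q) hQ le_rfl).ae_section, ae_ae_of_ae_invariant hQ h] with x h1 h2 h3 h4 h5
  simp only [tilt, h1.1]
  refine integral_mono_ae (h2.integrable_exp_mul h3) (h2.integrable_exp_mul h4)
    (h5.mono fun y hy => ?_)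
  exact mul_le_mul_of_nonneg_left hy (Real.exp_pos _).le

theorem tilt_one (hQ : Kernel.Invariant Q Q₀) (hu : MemHeart 1 (Q₀ ⊗ₘ Q) u)
    (hw : MemHeart 1 Q₀ w) : tilt Q u β θ w (fun _ => 1) =ᵐ[Q₀] fun _ => 1 := by
  filter_upwards [ae_distortion_eq (β := β) (θ := θ) hQ hu hw] with x h1
  simp only [tilt, h1.1, mul_one, h1.2]

theorem tilt_iterate_one (hQ : Kernel.Invariant Q Q₀) (hu : MemHeart 1 (Q₀ ⊗ₘ Q) u)
    (hw : MemHeart 1 Q₀ w) (n : ℕ) :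
    (tilt Q u β θ w)^[n] (fun _ => 1) =ᵐ[Q₀] fun _ => 1 := by
  induction n with
  | zero => rfl
  | succ n ih =>
    rw [Function.iterate_succ_apply']
    exact (tilt_congr hQ ih).trans (tilt_one hQ hu hw)

/-- Pointwise, `b (H + L) = b L + (1 - b) (b / (1 - b) H)` with `L = log E e^{|f|}`, so convexity of
`exp` gives a mixture of `E e^{|f|}` and a function free of `f`. Invariance turns the integral of
the first into `∫ exp |f|`, and a convex combination is at most the maximum. -/
theorem exists_integral_exp_tilt_le (hQ : Kernel.Invariant Q Q₀) (hu : MemHeart 1 (Q₀ ⊗ₘ Q) u)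
    (hw : MemHeart 1 Q₀ w) {b : ℝ} (hb0 : 0 < b) (hb1 : b < 1) :
    ∃ C : ℝ, ∀ f : X → ℝ, MemHeart 1 Q₀ f →
      Integrable (fun x => Real.exp |b * tilt Q u β θ w f x|) Q₀ ∧
      ∫ x, Real.exp |b * tilt Q u β θ w f x| ∂Q₀ ≤ max (∫ x, Real.exp |f x| ∂Q₀) C := by
  have hb1' : 0 < 1 - b := by linarith
  set H := entropic Q (fun p => 2 * logDistortion Q u β θ w p)
  have hH : MemHeart 1 Q₀ fun x => b / (1 - b) * H x :=
    ((memHeart_logDistortion hQ hu hw).const_mul le_rfl 2).entropic.const_mul le_rfl _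
  refine ⟨∫ x, Real.exp (b / (1 - b) * H x) ∂Q₀, fun f hf => ?_⟩
  have hf2 := (hf.comp_snd (Q := Q) hQ le_rfl).abs le_rfl
  have hi1 : Integrable (fun x => b * ∫ y, Real.exp |f y| ∂Q x) Q₀ :=
    (integrable_of_integrable_compProd hf2.integrable_exp).const_mul b
  have hi2 : Integrable (fun x => (1 - b) * Real.exp (b / (1 - b) * H x)) Q₀ :=
    hH.integrable_exp.const_mul _
  have hbound : ∀ᵐ x ∂Q₀, Real.exp |b * tilt Q u β θ w f x| ≤
      b * ∫ y, Real.exp |f y| ∂Q x + (1 - b) * Real.exp (b / (1 - b) * H x) := by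
    filter_upwards [ae_abs_tilt_le (β := β) (θ := θ) hQ hu hw hf, hf2.ae_section] with x h1 h2
    have h3 := convexOn_exp.2 (Set.mem_univ (entropic Q (fun p => |f p.2|) x))
      (Set.mem_univ (b / (1 - b) * H x)) hb0.le hb1'.le (by ring)
    simp only [smul_eq_mul] at h3
    rw [show Real.exp (entropic Q (fun p => |f p.2|) x) = ∫ y, Real.exp |f y| ∂Q x from
      Real.exp_log (integral_exp_pos h2.integrable_exp)] at h3
    refine le_trans (Real.exp_le_exp.2 ?_) h3
    rw [abs_mul, abs_of_pos hb0]
    calc b * |tilt Q u β θ w f x| ≤ b * (H x + entropic Q (fun p => |f p.2|) x) := by gcongr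
      _ = _ := by field_simp; ring
  have hint : Integrable (fun x => Real.exp |b * tilt Q u β θ w f x|) Q₀ := by
    refine (hi1.add hi2).mono' (Real.measurable_exp.comp_aemeasurable
      (continuous_abs.measurable.comp_aemeasurable
        ((aemeasurable_tilt hQ hu hw hf).const_mul b))).aestronglyMeasurable
      (hbound.mono fun x hx => ?_)
    rwa [Real.norm_eq_abs, Real.abs_exp]
  refine ⟨hint, (integral_mono_ae hint (hi1.add hi2) hbound).trans ?_⟩
  simp only [Pi.add_apply]
  rw [integral_add hi1 hi2, integral_const_mul, integral_const_mul,
    integral_integral_of_invariant hQ hf.integrable_exp_abs]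
  nlinarith [le_max_left (∫ x, Real.exp |f x| ∂Q₀) (∫ x, Real.exp (b / (1 - b) * H x) ∂Q₀),
    le_max_right (∫ x, Real.exp |f x| ∂Q₀) (∫ x, Real.exp (b / (1 - b) * H x) ∂Q₀)]

theorem memHeart_tilt (hQ : Kernel.Invariant Q Q₀) (hu : MemHeart 1 (Q₀ ⊗ₘ Q) u)
    (hw : MemHeart 1 Q₀ w) {f : X → ℝ} (hf : MemHeart 1 Q₀ f) :
    MemHeart 1 Q₀ (tilt Q u β θ w f) := by
  obtain ⟨C, hC⟩ := exists_integral_exp_tilt_le (β := β) (θ := θ) hQ hu hw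
    (b := 1 / 2) (by norm_num) (by norm_num)
  refine memHeart_of_forall_ge (aemeasurable_tilt hQ hu hw hf) fun t ht => ?_
  -- By homogeneity, `b = 1 / 2` applied to `2 t f` gives the exponential moment of order `t`.
  refine (hC _ (hf.const_mul le_rfl (2 * t))).1.congr (ae_of_all _ fun x => ?_)
  simp only [tilt_const_mul]
  rw [← mul_assoc, abs_mul, show 1 / 2 * (2 * t) = t by ring, abs_of_pos (by linarith)]

theorem memHeart_tilt_iterate (hQ : Kernel.Invariant Q Q₀) (hu : MemHeart 1 (Q₀ ⊗ₘ Q) u)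
    (hw : MemHeart 1 Q₀ w) (n : ℕ) {f : X → ℝ} (hf : MemHeart 1 Q₀ f) :
    MemHeart 1 Q₀ ((tilt Q u β θ w)^[n] f) := by
  induction n with
  | zero => exact hf
  | succ n ih =>
    rw [Function.iterate_succ_apply']
    exact memHeart_tilt hQ hu hw ih

/-- The one-step bound applied to `b ^ n` times the `n`-th iterate; the maximum with `C` is
preserved, so `C` does not grow with `n`. -/
theorem exists_integral_exp_tilt_iterate_le (hQ : Kernel.Invariant Q Q₀)
    (hu : MemHeart 1 (Q₀ ⊗ₘ Q) u) (hw : MemHeart 1 Q₀ w) {b : ℝ} (hb0 : 0 < b) (hb1 : b < 1) :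
    ∃ C : ℝ, ∀ f : X → ℝ, MemHeart 1 Q₀ f → ∀ n : ℕ,
      ∫ x, Real.exp |b ^ n * (tilt Q u β θ w)^[n] f x| ∂Q₀ ≤ max (∫ x, Real.exp |f x| ∂Q₀) C := by
  obtain ⟨C, hC⟩ := exists_integral_exp_tilt_le (β := β) (θ := θ) hQ hu hw hb0 hb1
  refine ⟨C, fun f hf n => ?_⟩
  induction n with
  | zero => simp
  | succ n ih =>
    refine le_trans (le_of_eq ?_) (((hC _ ((memHeart_tilt_iterate (β := β) (θ := θ) hQ hu hw n
      hf).const_mul le_rfl (b ^ n))).2).trans (max_le ih (le_max_right _ _)))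
    congr 1 with x
    rw [tilt_const_mul, Function.iterate_succ_apply']
    congr 2
    ring

theorem exists_heartOpNorm_D_iterate_le (hQ : Kernel.Invariant Q Q₀)
    (hu : MemHeart 1 (Q₀ ⊗ₘ Q) u) (hw : MemHeart 1 Q₀ w) (hβ : 0 < β)
    {b : ℝ} (hb0 : 0 < b) (hb1 : b < 1) :
    ∃ C : ℝ, 0 < C ∧ ∀ n : ℕ,
      heartOpNorm 1 Q₀ ((D Q u β θ w)^[n]) ≤ ENNReal.ofReal (C * (β / b) ^ n) := by
  obtain ⟨C, hC⟩ := exists_integral_exp_tilt_iterate_le (β := β) (θ := θ) hQ hu hw hb0 hb1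
  -- Inner `2`: the exponential integral of `f / 2` on the unit ball. Outer `2`: undoes the halving.
  refine ⟨2 * max 2 C, by positivity, fun n => ?_⟩
  refine iSup_le fun f => iSup_le fun hf => iSup_le fun h1 => ?_
  have hf2 := hf.const_mul le_rfl (1 / 2)
  have h2 := integral_exp_half_le hf h1
  have h3 : (D Q u β θ w)^[n] f = fun x => (2 * (β / b) ^ n) *
      (b ^ n * (tilt Q u β θ w)^[n] (fun x => 1 / 2 * f x) x) := by
    rw [D_eq_tilt, iterate_const_mul_tilt,
      iterate_homogeneous (tilt_const_mul Q u β θ w)]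
    ext x
    rw [div_pow]
    field_simp
  rw [h3, luxNorm_const_mul (by positivity), mul_right_comm,
    ENNReal.ofReal_mul (p := 2 * (β / b) ^ n) (by positivity)]
  refine mul_le_mul_right ?_ _
  refine (luxNorm_one_le_integral_exp ((memHeart_tilt_iterate hQ hu hw n hf2).const_mul le_rfl
    _).integrable_exp_abs).trans ?_
  refine ENNReal.ofReal_le_ofReal ((hC _ hf2 n).trans ?_)
  exact max_le_max_right _ h2

theorem memHeart_D (hQ : Kernel.Invariant Q Q₀) (hu : MemHeart 1 (Q₀ ⊗ₘ Q) u)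
    (hw : MemHeart 1 Q₀ w) {f : X → ℝ} (hf : MemHeart 1 Q₀ f) :
    MemHeart 1 Q₀ (D Q u β θ w f) :=
  (memHeart_tilt hQ hu hw hf).const_mul le_rfl β

theorem memHeart_D_iterate (hQ : Kernel.Invariant Q Q₀) (hu : MemHeart 1 (Q₀ ⊗ₘ Q) u)
    (hw : MemHeart 1 Q₀ w) (n : ℕ) {f : X → ℝ} (hf : MemHeart 1 Q₀ f) :
    MemHeart 1 Q₀ ((D Q u β θ w)^[n] f) := by
  rw [D_eq_tilt, iterate_const_mul_tilt]
  exact (memHeart_tilt_iterate hQ hu hw n hf).const_mul le_rfl _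

theorem heartOpNorm_D_iterate_lt_top (hQ : Kernel.Invariant Q Q₀)
    (hu : MemHeart 1 (Q₀ ⊗ₘ Q) u) (hw : MemHeart 1 Q₀ w) (hβ : 0 < β) (n : ℕ) :
    heartOpNorm 1 Q₀ ((D Q u β θ w)^[n]) < ∞ := by
  obtain ⟨C, -, hC⟩ := exists_heartOpNorm_D_iterate_le (θ := θ) hQ hu hw hβ
    (b := 1 / 2) (by norm_num) (by norm_num)
  exact (hC n).trans_lt ENNReal.ofReal_lt_top

/-- Tested on the constant `1`: tilting preserves constants, so each application multiplies by `β`.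
-/
theorem pow_le_heartOpNorm_D_iterate (hQ : Kernel.Invariant Q Q₀)
    (hu : MemHeart 1 (Q₀ ⊗ₘ Q) u) (hw : MemHeart 1 Q₀ w) (hβ : 0 < β) (n : ℕ) :
    ENNReal.ofReal (β ^ n) ≤ heartOpNorm 1 Q₀ ((D Q u β θ w)^[n]) := by
  have h1 : MemHeart 1 Q₀ fun _ => (1 : ℝ) := memHeart_const le_rfl 1
  have h := luxNorm_le_heartOpNorm_mul (iterate_homogeneous (D_const_mul Q u β θ w) n)
    (heartOpNorm_D_iterate_lt_top hQ hu hw hβ n) h1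
  have h2 : (D Q u β θ w)^[n] (fun _ => 1) =ᵐ[Q₀] fun _ => β ^ n * 1 := by
    rw [D_eq_tilt, iterate_const_mul_tilt]
    filter_upwards [tilt_iterate_one (β := β) (θ := θ) hQ hu hw n] with x hx
    rw [hx]
  rw [luxNorm_congr h2, luxNorm_const_mul (pow_pos hβ n)] at h
  exact (ENNReal.mul_le_mul_iff_left
    (zero_lt_one.trans_le one_le_luxNorm_one).ne' h1.1.2.ne).1 h

theorem tendsto_rootNorm_D (hQ : Kernel.Invariant Q Q₀)
    (hu : MemHeart 1 (Q₀ ⊗ₘ Q) u) (hw : MemHeart 1 Q₀ w) (hβ : 0 < β) :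
    Tendsto (rootNorm 1 Q₀ (D Q u β θ w)) atTop
      (𝓝 (heartSpectralRadius 1 Q₀ (D Q u β θ w))) := by
  refine tendsto_nhds_limUnder (tendsto_rpow_one_div_of_submultiplicative hβ
    (fun n => (heartOpNorm_D_iterate_lt_top hQ hu hw hβ n).ne)
    (pow_le_heartOpNorm_D_iterate hQ hu hw hβ) fun m n => ?_)
  rw [Function.iterate_add]
  exact heartOpNorm_comp_le (iterate_homogeneous (D_const_mul Q u β θ w) m)
    (heartOpNorm_D_iterate_lt_top hQ hu hw hβ m) fun f hf => memHeart_D_iterate hQ hu hw n hf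

/-- With `β < b < 1` the norms are at most `C (β/b)^n`, and `C ^ (1/n)` tends to one. Only
membership of `w` in the heart enters, not the fixed-point equation. -/
theorem isStable_of_memHeart (hQ : Kernel.Invariant Q Q₀) (hu : MemHeart 1 (Q₀ ⊗ₘ Q) u)
    (hw : MemHeart 1 Q₀ w) (hβ : 0 < β) (hβ1 : β < 1) : IsStable Q₀ Q u β θ w := by
  obtain ⟨b, hb1, hb2⟩ := exists_between hβ1
  have hb0 : 0 < b := hβ.trans hb1
  obtain ⟨C, hC0, hC⟩ := exists_heartOpNorm_D_iterate_le (θ := θ) hQ hu hw hβ hb0 hb2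
  have hq : 0 < β / b := by positivity
  have h1 : Tendsto (fun n : ℕ => ENNReal.ofReal (C ^ (1 / (n : ℝ)) * (β / b))) atTop
      (𝓝 (ENNReal.ofReal (C ^ (0 : ℝ) * (β / b)))) := by
    refine ENNReal.tendsto_ofReal (Tendsto.mul_const _ ?_)
    exact (Real.continuousAt_const_rpow hC0.ne').tendsto.comp tendsto_one_div_atTop_nhds_zero_nat
  have h2 : heartSpectralRadius 1 Q₀ (D Q u β θ w) ≤ ENNReal.ofReal (C ^ (0 : ℝ) * (β / b)) := by
    refine le_of_tendsto_of_tendsto (tendsto_rootNorm_D hQ hu hw hβ) h1 ?_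
    filter_upwards [eventually_gt_atTop 0] with n hn
    have hn' : (n : ℝ) ≠ 0 := by exact_mod_cast hn.ne'
    refine (ENNReal.rpow_le_rpow (hC n) (by positivity)).trans_eq ?_
    rw [ENNReal.ofReal_rpow_of_pos (by positivity), Real.mul_rpow hC0.le (by positivity),
      ← Real.rpow_natCast (β / b), ← Real.rpow_mul hq.le, mul_one_div_cancel hn', Real.rpow_one]
  refine h2.trans_lt ?_
  rw [Real.rpow_zero, one_mul, ENNReal.ofReal_lt_one, div_lt_one hb0]
  exact hb1

theorem T_sub_le_D (hQ : Kernel.Invariant Q Q₀) (hu : MemHeart 1 (Q₀ ⊗ₘ Q) u) (hβ : 0 < β)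
    {v : X → ℝ} (hv : MemHeart 1 Q₀ v) (hw : MemHeart 1 Q₀ w) :
    ∀ᵐ x ∂Q₀, T Q u β θ v x - T Q u β θ w x ≤ D Q u β θ v (fun y => v y - w y) x := by
  filter_upwards [ae_distortion_eq (β := β) (θ := θ) hQ hu hv,
    (memHeart_exponent (β := β) (θ := θ) hQ hu hv).ae_section,
    (memHeart_exponent (β := β) (θ := θ) hQ hu hw).ae_section] with x h1 h2 h3
  have h := log_integral_exp_sub_le h2 h3
  simp only [add_sub_add_right_eq_sub] at h
  simp only [T_eq_entropic, D, h1.1, ← mul_sub]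
  exact mul_le_mul_of_nonneg_left h hβ.le

/-- Since `x ≤ exp x`, the numbers `q ^ n ∫ e` stay below `K`, which is impossible if `∫ e > 0`. -/
theorem ae_le_zero_of_integral_exp_bounded {e : X → ℝ} (he : MemHeart 1 Q₀ e)
    (he0 : ∀ x, 0 ≤ e x) {q K : ℝ} (hq : 1 < q)
    (h : ∀ n : ℕ, ∫ x, Real.exp (q ^ n * e x) ∂Q₀ ≤ K) : e =ᵐ[Q₀] 0 := by
  rw [← integral_eq_zero_iff_of_nonneg he0 he.integrable]
  by_contra hne
  have hpos : 0 < ∫ x, e x ∂Q₀ := lt_of_le_of_ne (integral_nonneg he0) (Ne.symm hne)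
  obtain ⟨n, hn⟩ := pow_unbounded_of_one_lt (K / ∫ x, e x ∂Q₀) hq
  rw [div_lt_iff₀ hpos, ← integral_const_mul] at hn
  refine absurd (hn.trans_le ?_) (lt_irrefl K)
  refine le_trans (integral_mono (he.integrable.const_mul _)
    (he.const_mul le_rfl _).integrable_exp fun x => ?_) (h n)
  linarith [Real.add_one_le_exp (q ^ n * e x)]

theorem IsFixedPoint.ae_le (hQ : Kernel.Invariant Q Q₀) (hu : MemHeart 1 (Q₀ ⊗ₘ Q) u)
    (hβ : 0 < β) (hβ1 : β < 1) {v : X → ℝ} (hv : IsFixedPoint 1 Q₀ Q u β θ v)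
    (hw : IsFixedPoint 1 Q₀ Q u β θ w) : v ≤ᵐ[Q₀] w := by
  obtain ⟨hv, hvT⟩ := hv
  obtain ⟨hw, hwT⟩ := hw
  obtain ⟨b, hb1, hb2⟩ := exists_between hβ1
  have hb0 : 0 < b := hβ.trans hb1
  have hd : MemHeart 1 Q₀ fun x => v x - w x := hv.sub hw
  set e : X → ℝ := fun x => max (v x - w x) 0
  have he0 : ∀ x, 0 ≤ e x := fun x => le_max_right _ _
  have he : MemHeart 1 Q₀ e := hd.mono le_rfl (hd.aemeasurable.max aemeasurable_const)
    (ae_of_all _ fun x => by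
      rw [abs_of_nonneg (he0 x)]
      exact max_le (le_abs_self _) (abs_nonneg _))
  -- Subgradient inequality for the two fixed points, then positivity of the tilt to pass from `v -
  -- w` to its positive part.
  have hstep : ∀ᵐ x ∂Q₀, e x ≤ β * tilt Q u β θ v e x := by
    filter_upwards [T_sub_le_D (θ := θ) hQ hu hβ hv hw, hvT, hwT,
      tilt_mono (β := β) (θ := θ) hQ hu hv hd he (ae_of_all _ fun x => le_max_left _ _),
      tilt_mono (β := β) (θ := θ) hQ hu hv ((memHeart_const le_rfl 0)) he
        (ae_of_all _ fun x => he0 x)] with x h1 h2 h3 h4 h5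
    rw [h2, h3] at h1
    have h5' : 0 ≤ tilt Q u β θ v e x := by simpa [tilt] using h5
    exact max_le (h1.trans (mul_le_mul_of_nonneg_left h4 hβ.le)) (by positivity)
  obtain ⟨C, hC⟩ := exists_integral_exp_tilt_le (β := β) (θ := θ) hQ hu hv hb0 hb2
  -- Each use of `hstep` gains a factor `b / β > 1`, because the tilt bound tolerates `b` while the
  -- inequality carries only `β`.
  have hbound : ∀ n : ℕ, ∫ x, Real.exp ((b / β) ^ n * e x) ∂Q₀ ≤
      max (∫ x, Real.exp (e x) ∂Q₀) C := by
    intro n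
    induction n with
    | zero => simp
    | succ n ih =>
      obtain ⟨hi, hle⟩ := hC _ (he.const_mul le_rfl ((b / β) ^ n))
      have h1 : ∀ x, |(b / β) ^ n * e x| = (b / β) ^ n * e x := fun x =>
        abs_of_nonneg (mul_nonneg (by positivity) (he0 x))
      simp only [h1] at hle
      refine le_trans (integral_mono_ae (he.const_mul le_rfl _).integrable_exp hi ?_)
        (hle.trans (max_le ih (le_max_right _ _)))
      filter_upwards [hstep] with x hx
      refine Real.exp_le_exp.2 (le_trans ?_ (le_abs_self _))
      rw [tilt_const_mul]
      calc (b / β) ^ (n + 1) * e x ≤ (b / β) ^ (n + 1) * (β * tilt Q u β θ v e x) := by gcongr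
        _ = _ := by rw [pow_succ]; field_simp
  have hzero := ae_le_zero_of_integral_exp_bounded he he0 ((one_lt_div hβ).2 hb1) hbound
  filter_upwards [hzero] with x hx
  have : v x - w x ≤ 0 := (le_max_left _ _).trans_eq hx
  linarith

end Tilt

/-! ### Modular bounds for `log E exp` at a general exponent -/

section Contraction

theorem sub_le_rpow_sub_rpow {a b s : ℝ} (hs : 1 ≤ s) (hb : 1 ≤ b) (hab : b ≤ a) :
    a - b ≤ a ^ s - b ^ s := by
  have hb0 : 0 < b := by linarith
  have ha0 : 0 < a := by linarith
  have h1 : 1 ≤ b ^ (s - 1) := Real.one_le_rpow hb (by linarith)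
  have h2 : b ^ (s - 1) ≤ a ^ (s - 1) := Real.rpow_le_rpow hb0.le hab (by linarith)
  have h3 : a ^ s = a ^ (s - 1) * a := by rw [← Real.rpow_add_one ha0.ne']; ring_nf
  have h4 : b ^ s = b ^ (s - 1) * b := by rw [← Real.rpow_add_one hb0.ne']; ring_nf
  rw [h3, h4]
  nlinarith

/-- Below `L` the left side is at most one. Above it, `x ^ s` has slope at least one beyond `1`, and
`c ≤ 1 / 2` turns slope `1 / c` into at least `2`. -/
theorem exp_two_mul_sub_le {s c L y : ℝ} (hs : 1 ≤ s) (hc : 0 < c) (hc2 : c ≤ 1 / 2)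
    (hL : c ≤ L) :
    Real.exp (2 * (y - L)) ≤ 1 + Real.exp ((y / c) ^ s - (L / c) ^ s) := by
  rcases le_total y L with h | h
  · have : Real.exp (2 * (y - L)) ≤ 1 := Real.exp_le_one_iff.2 (by linarith)
    linarith [Real.exp_pos ((y / c) ^ s - (L / c) ^ s)]
  · have h1 := sub_le_rpow_sub_rpow hs ((one_le_div hc).2 hL) (div_le_div_of_nonneg_right h hc.le)
    have h2 : 2 * (y - L) ≤ y / c - L / c := by
      rw [← sub_div, le_div_iff₀ hc]
      nlinarith
    have := Real.exp_le_exp.2 (h2.trans h1)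
    linarith

variable {Ω : Type*} [MeasurableSpace Ω] {μ : Measure Ω}

/-- Fatou's lemma; used to keep the limit of the iteration in the heart. -/
theorem integrable_of_tendsto_of_integral_le {F : ℕ → Ω → ℝ} {G : Ω → ℝ}
    (hF : ∀ n, Integrable (F n) μ) (hF0 : ∀ n x, 0 ≤ F n x) {K : ℝ}
    (hK : ∀ n, ∫ x, F n x ∂μ ≤ K) (hG0 : ∀ x, 0 ≤ G x)
    (h : ∀ᵐ x ∂μ, Tendsto (fun n => F n x) atTop (𝓝 (G x))) : Integrable G μ := by
  have hm : AEMeasurable G μ := aemeasurable_of_tendsto_metrizable_ae atTop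
    (fun n => (hF n).aemeasurable) h
  rw [← lintegral_ofReal_ne_top_iff_integrable hm.aestronglyMeasurable (ae_of_all _ hG0)]
  have h1 : ∫⁻ x, ENNReal.ofReal (G x) ∂μ =
      ∫⁻ x, liminf (fun n => ENNReal.ofReal (F n x)) atTop ∂μ :=
    lintegral_congr_ae (h.mono fun x hx => ((ENNReal.tendsto_ofReal hx).liminf_eq).symm)
  rw [h1]
  refine ne_top_of_le_ne_top (ENNReal.ofReal_ne_top (r := K))
    ((lintegral_liminf_le' fun n => (hF n).aemeasurable.ennreal_ofReal).trans ?_)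
  refine liminf_le_of_le (by isBoundedDefault) fun b hb => ?_
  obtain ⟨n, hn⟩ := hb.exists
  refine hn.trans ?_
  rw [← ofReal_integral_eq_lintegral_ofReal (hF n) (ae_of_all _ (hF0 n))]
  exact ENNReal.ofReal_le_ofReal (hK n)

variable [IsProbabilityMeasure μ]

theorem one_le_integral_exp_of_nonneg {F : Ω → ℝ} (hF : ∀ ω, 0 ≤ F ω)
    (hi : Integrable (fun ω => Real.exp (F ω)) μ) : 1 ≤ ∫ ω, Real.exp (F ω) ∂μ := by
  have : ∫ _ω, (1 : ℝ) ∂μ ≤ ∫ ω, Real.exp (F ω) ∂μ :=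
    integral_mono (integrable_const 1) hi fun ω => Real.one_le_exp (hF ω)
  simpa using this

theorem div_rpow_one_div_rpow {s c a : ℝ} (hs : 1 ≤ s) (hc : 0 < c) (ha : 0 ≤ a) :
    (c * a ^ (1 / s) / c) ^ s = a := by
  rw [mul_div_cancel_left₀ _ hc.ne', ← Real.rpow_mul ha, one_div_mul_cancel (by linarith),
    Real.rpow_one]

/-- The levels `L`, `N` solve `(L/c)^s = 1 + log A` and `(N/d)^s = 1 + log B`, so each normalized
exponential has mean `e⁻¹`. Splitting the sum by convexity of `exp` gives `E exp (|f| + |g| - L - N)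
≤ 2`. The coefficient of the `f` term is exactly `c`. -/
theorem log_integral_exp_add_le {f g : Ω → ℝ} {s c d : ℝ} (hs : 1 ≤ s)
    (hc : 0 < c) (hc2 : c ≤ 1 / 2) (hd : 0 < d) (hd2 : d ≤ 1 / 2)
    (hf : Integrable (fun ω => Real.exp ((|f ω| / c) ^ s)) μ)
    (hg : Integrable (fun ω => Real.exp ((|g ω| / d) ^ s)) μ)
    (hfg : Integrable (fun ω => Real.exp (|f ω| + |g ω|)) μ) :
    Real.log (∫ ω, Real.exp (|f ω| + |g ω|) ∂μ) ≤
      c * (1 + Real.log (∫ ω, Real.exp ((|f ω| / c) ^ s) ∂μ)) ^ (1 / s) +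
      d * (1 + Real.log (∫ ω, Real.exp ((|g ω| / d) ^ s) ∂μ)) ^ (1 / s) + Real.log 2 := by
  have hA1 := one_le_integral_exp_of_nonneg (fun ω => Real.rpow_nonneg (by positivity) s) hf
  have hB1 := one_le_integral_exp_of_nonneg (fun ω => Real.rpow_nonneg (by positivity) s) hg
  set A := ∫ ω, Real.exp ((|f ω| / c) ^ s) ∂μ
  set B := ∫ ω, Real.exp ((|g ω| / d) ^ s) ∂μ
  have hlA := Real.log_nonneg hA1
  have hlB := Real.log_nonneg hB1
  set L := c * (1 + Real.log A) ^ (1 / s)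
  set N := d * (1 + Real.log B) ^ (1 / s)
  have hL : c ≤ L := by
    have := Real.one_le_rpow (show 1 ≤ 1 + Real.log A by linarith) (by positivity : 0 ≤ 1 / s)
    nlinarith
  have hN : d ≤ N := by
    have := Real.one_le_rpow (show 1 ≤ 1 + Real.log B by linarith) (by positivity : 0 ≤ 1 / s)
    nlinarith
  have hLs : (L / c) ^ s = 1 + Real.log A := div_rpow_one_div_rpow hs hc (by linarith)
  have hNs : (N / d) ^ s = 1 + Real.log B := div_rpow_one_div_rpow hs hd (by linarith)
  have hexpA : Real.exp (1 + Real.log A) = Real.exp 1 * A := by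
    rw [Real.exp_add, Real.exp_log (by linarith)]
  have hexpB : Real.exp (1 + Real.log B) = Real.exp 1 * B := by
    rw [Real.exp_add, Real.exp_log (by linarith)]
  have hbound : ∫ ω, Real.exp (|f ω| + |g ω|) * Real.exp (-(L + N)) ∂μ ≤
      ∫ ω, (1 + (1 / 2 * (Real.exp ((|f ω| / c) ^ s) / (Real.exp 1 * A)) +
        1 / 2 * (Real.exp ((|g ω| / d) ^ s) / (Real.exp 1 * B)))) ∂μ := by
    refine integral_mono (hfg.mul_const _) ((integrable_const 1).add
      (((hf.div_const _).const_mul _).add ((hg.div_const _).const_mul _))) fun ω => ?_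
    have h1 := exp_two_mul_sub_le (y := |f ω|) hs hc hc2 hL
    have h2 := exp_two_mul_sub_le (y := |g ω|) hs hd hd2 hN
    rw [hLs, Real.exp_sub, hexpA] at h1
    rw [hNs, Real.exp_sub, hexpB] at h2
    have h3 := convexOn_exp.2 (Set.mem_univ (2 * (|f ω| - L))) (Set.mem_univ (2 * (|g ω| - N)))
      (show (0 : ℝ) ≤ 1 / 2 by norm_num) (show (0 : ℝ) ≤ 1 / 2 by norm_num) (by norm_num)
    simp only [smul_eq_mul] at h3
    rw [← Real.exp_add, show |f ω| + |g ω| + -(L + N) =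
      1 / 2 * (2 * (|f ω| - L)) + 1 / 2 * (2 * (|g ω| - N)) by ring]
    linarith
  have hi : Integrable (fun ω => 1 / 2 * (Real.exp ((|f ω| / c) ^ s) / (Real.exp 1 * A)) +
      1 / 2 * (Real.exp ((|g ω| / d) ^ s) / (Real.exp 1 * B))) μ :=
    ((hf.div_const _).const_mul _).add ((hg.div_const _).const_mul _)
  rw [integral_mul_const, integral_add (integrable_const 1) hi,
    integral_add ((hf.div_const _).const_mul _) ((hg.div_const _).const_mul _),
    integral_const_mul, integral_const_mul, integral_div, integral_div] at hbound
  simp only [integral_const, probReal_univ, smul_eq_mul, one_mul] at hbound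
  have hA0 : A ≠ 0 := by linarith
  have hB0 : B ≠ 0 := by linarith
  have he := Real.add_one_le_exp 1
  have h4 : A / (Real.exp 1 * A) ≤ 1 := by
    rw [div_le_one (by positivity)]; nlinarith
  have h5 : B / (Real.exp 1 * B) ≤ 1 := by
    rw [div_le_one (by positivity)]; nlinarith
  have h6 : ∫ ω, Real.exp (|f ω| + |g ω|) ∂μ ≤ Real.exp (L + N) * 2 := by
    rw [Real.exp_neg, ← div_eq_mul_inv, div_le_iff₀ (Real.exp_pos _)] at hbound
    nlinarith [Real.exp_pos (L + N)]
  have h7 := Real.log_le_log (integral_exp_pos hfg) h6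
  rwa [Real.log_mul (Real.exp_pos _).ne' two_ne_zero, Real.log_exp] at h7

/-- Contraction of the modular under `b log E exp`, with the slack absorbed by `g`. -/
theorem exp_log_integral_exp_add_rpow_le {f g : Ω → ℝ} {s b c d : ℝ} (hs : 1 ≤ s)
    (hb0 : 0 < b) (hb1 : b < 1) (hc : 0 < c) (hc2 : c ≤ 1 / 2) (hd : d = (1 - b) * c / 2)
    (hf : Integrable (fun ω => Real.exp ((|f ω| / c) ^ s)) μ)
    (hg : Integrable (fun ω => Real.exp ((|g ω| / d) ^ s)) μ)
    (hfg : Integrable (fun ω => Real.exp (|f ω| + |g ω|)) μ) :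
    Real.exp ((b * Real.log (∫ ω, Real.exp (|f ω| + |g ω|) ∂μ) / c) ^ s) ≤
      b * ∫ ω, Real.exp ((|f ω| / c) ^ s) ∂μ + (1 - b) *
        (Real.exp (b / (1 - b) + 1 + (Real.log 2 / d) ^ s) *
          ∫ ω, Real.exp ((|g ω| / d) ^ s) ∂μ) := by
  have hb1' : 0 < 1 - b := by linarith
  have hd0 : 0 < d := by rw [hd]; positivity
  have hd2 : d ≤ 1 / 2 := by rw [hd]; nlinarith
  have hΛ := log_integral_exp_add_le hs hc hc2 hd0 hd2 hf hg hfg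
  have hΛ0 := Real.log_nonneg (one_le_integral_exp_of_nonneg (fun ω => by positivity) hfg)
  have hA1 := one_le_integral_exp_of_nonneg (fun ω => Real.rpow_nonneg (by positivity) s) hf
  have hB1 := one_le_integral_exp_of_nonneg (fun ω => Real.rpow_nonneg (by positivity) s) hg
  set Λ := Real.log (∫ ω, Real.exp (|f ω| + |g ω|) ∂μ)
  set A := ∫ ω, Real.exp ((|f ω| / c) ^ s) ∂μ
  set B := ∫ ω, Real.exp ((|g ω| / d) ^ s) ∂μ
  have hlA := Real.log_nonneg hA1
  have hlB := Real.log_nonneg hB1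
  have hl2 : 0 < Real.log 2 := Real.log_pos (by norm_num)
  have hLs := div_rpow_one_div_rpow hs hc (show 0 ≤ 1 + Real.log A by linarith)
  have hNs := div_rpow_one_div_rpow hs hd0 (show 0 ≤ 1 + Real.log B by linarith)
  have hL0 : 0 ≤ c * (1 + Real.log A) ^ (1 / s) := by positivity
  have hN0 : 0 ≤ d * (1 + Real.log B) ^ (1 / s) := by positivity
  set L := c * (1 + Real.log A) ^ (1 / s)
  set N := d * (1 + Real.log B) ^ (1 / s)
  -- The choice of `d` makes `(1 - b) / (2 d) = 1 / c`, so `N` and `log 2` fit into the leftover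
  -- convex weight `1 - b`, halved between them.
  have h1 : b * Λ / c ≤ b * (L / c) + (1 - b) * (1 / 2 * (N / d) + 1 / 2 * (Real.log 2 / d)) := by
    have h2 : (1 - b) * (1 / 2 * (N / d) + 1 / 2 * (Real.log 2 / d)) = (N + Real.log 2) / c := by
      rw [hd]; field_simp
    rw [h2, mul_div_assoc', ← add_div]
    gcongr
    nlinarith
  have hx : 0 ≤ L / c := by positivity
  have hy : 0 ≤ N / d := by positivity
  have hz : 0 ≤ Real.log 2 / d := by positivity
  have h3 := (convexOn_rpow hs).2 (Set.mem_Ici.2 hx)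
    (Set.mem_Ici.2 (show 0 ≤ 1 / 2 * (N / d) + 1 / 2 * (Real.log 2 / d) by positivity))
    hb0.le hb1'.le (by ring)
  have h4 := (convexOn_rpow hs).2 (Set.mem_Ici.2 hy) (Set.mem_Ici.2 hz)
    (show (0 : ℝ) ≤ 1 / 2 by norm_num) (show (0 : ℝ) ≤ 1 / 2 by norm_num) (by norm_num)
  simp only [smul_eq_mul] at h3 h4
  rw [hLs] at h3
  rw [hNs] at h4
  have hz' := Real.rpow_nonneg hz s
  have h5 : (b * Λ / c) ^ s ≤ b * Real.log A +
      (1 - b) * (b / (1 - b) + 1 + (Real.log 2 / d) ^ s + Real.log B) := by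
    have h6 : (1 - b) * (b / (1 - b)) = b := by field_simp
    calc (b * Λ / c) ^ s ≤ _ := Real.rpow_le_rpow (by positivity) h1 (by linarith)
      _ ≤ _ := h3
      _ ≤ b * (1 + Real.log A) + (1 - b) * (1 + Real.log B + (Real.log 2 / d) ^ s) := by
        gcongr
        linarith
      _ = b * Real.log A + (1 - b) * (1 + (Real.log 2 / d) ^ s + Real.log B) + b := by ring
      _ = _ := by linear_combination -h6
  have h7 := convexOn_exp.2 (Set.mem_univ (Real.log A))
    (Set.mem_univ (b / (1 - b) + 1 + (Real.log 2 / d) ^ s + Real.log B)) hb0.le hb1'.le (by ring)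
  simp only [smul_eq_mul] at h7
  rw [Real.exp_add _ (Real.log B), Real.exp_log (show 0 < A by linarith),
    Real.exp_log (show 0 < B by linarith)] at h7
  exact (Real.exp_le_exp.2 h5).trans h7

end Contraction

/-! ### Existence of a fixed point by monotone iteration -/

section Existence

variable {X : Type*} [MeasurableSpace X] {Q₀ : Measure X} [IsProbabilityMeasure Q₀]
  {Q : Kernel X X} [IsMarkovKernel Q] {u : X × X → ℝ} {β θ r : ℝ}

theorem memHeart_of_forall_le_half {f : X → ℝ} (hr : 1 ≤ r) (hf : AEMeasurable f Q₀)
    (h : ∀ c : ℝ, 0 < c → c ≤ 1 / 2 → Integrable (fun x => Real.exp ((|f x| / c) ^ r)) Q₀) :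
    MemHeart r Q₀ f := by
  refine (memHeart_iff hr).2 ⟨hf, fun c hc => ?_⟩
  have hm : 0 < min c (1 / 2) := lt_min hc (by norm_num)
  refine (h (min c (1 / 2)) hm (min_le_right _ _)).mono'
    (aemeasurable_exp_rpow hf r c).aestronglyMeasurable (ae_of_all _ fun x => ?_)
  rw [Real.norm_eq_abs, Real.abs_exp]
  gcongr
  exact min_le_left _ _

/-- The conditional modular contraction with slack `α u`, integrated against the invariant law. As
the bound is a maximum with a constant free of `f`, it is uniform along iterates. -/
theorem exists_integral_exp_T_rpow_le (hQ : Kernel.Invariant Q Q₀) (hr : 1 ≤ r)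
    (hu : MemHeart r (Q₀ ⊗ₘ Q) u) (hβ0 : 0 < β) (hβ1 : β < 1) {c : ℝ} (hc : 0 < c)
    (hc2 : c ≤ 1 / 2) :
    ∃ C : ℝ, ∀ f : X → ℝ, MemHeart r Q₀ f →
      Integrable (fun x => Real.exp ((|T Q u β θ f x| / c) ^ r)) Q₀ ∧
      ∫ x, Real.exp ((|T Q u β θ f x| / c) ^ r) ∂Q₀ ≤
        max (∫ x, Real.exp ((|f x| / c) ^ r) ∂Q₀) C := by
  have hβ1' : 0 < 1 - β := by linarith
  set d : ℝ := (1 - β) * c / 2 with hd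
  have hd0 : 0 < d := by positivity
  set h : X × X → ℝ := fun p => alpha β θ * u p
  have hh : MemHeart r (Q₀ ⊗ₘ Q) h := hu.const_mul hr _
  have hh1 : MemHeart 1 (Q₀ ⊗ₘ Q) h := hh.mono_exponent le_rfl hr
  have hhi := ((memHeart_iff hr).1 hh).2 d hd0
  set E := Real.exp (β / (1 - β) + 1 + (Real.log 2 / d) ^ r)
  refine ⟨E * ∫ x, ∫ y, Real.exp ((|h (x, y)| / d) ^ r) ∂Q x ∂Q₀, fun f hf => ?_⟩
  have hf1 := hf.mono_exponent le_rfl hr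
  have hfi := ((memHeart_iff hr).1 hf).2 c hc
  have hfi2 := ((memHeart_iff hr).1 (hf.comp_snd (Q := Q) hQ hr)).2 c hc
  have hG := memHeart_exponent (β := β) (θ := θ) hQ (hu.mono_exponent le_rfl hr) hf1
  have hT := memHeart_T (β := β) (θ := θ) hQ (hu.mono_exponent le_rfl hr) hf1
  have hi1 := (integrable_of_integrable_compProd hfi2).const_mul β
  have hi2 := ((integrable_of_integrable_compProd hhi).const_mul E).const_mul (1 - β)
  have hbound : ∀ᵐ x ∂Q₀, Real.exp ((|T Q u β θ f x| / c) ^ r) ≤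
      β * ∫ y, Real.exp ((|f y| / c) ^ r) ∂Q x +
        (1 - β) * (E * ∫ y, Real.exp ((|h (x, y)| / d) ^ r) ∂Q x) := by
    filter_upwards [ae_integrable_of_integrable_compProd hfi2,
      ae_integrable_of_integrable_compProd hhi, hG.ae_section,
      (hf1.comp_snd (Q := Q) hQ le_rfl).ae_section, hh1.ae_section] with x h1 h2 h3 h4 h5
    have hs := (h4.abs le_rfl).add (h5.abs le_rfl)
    refine le_trans (Real.exp_le_exp.2 ?_) (exp_log_integral_exp_add_rpow_le hr hβ0 hβ1 hc hc2 hd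
      h1 h2 hs.integrable_exp)
    have h6 := log_integral_exp_mono h3 hs (ae_of_all _ fun y =>
      add_le_add (le_abs_self _) (le_abs_self _))
    have h7 := neg_log_integral_exp_neg_le h3
    have h8 := log_integral_exp_mono (h3.neg le_rfl) hs (ae_of_all _ fun y => by
      rw [neg_add]
      exact add_le_add (neg_le_abs _) (neg_le_abs _))
    rw [T_eq_entropic, abs_mul, abs_of_pos hβ0]
    gcongr
    exact abs_le.2 ⟨by unfold entropic; linarith, h6⟩
  have hint : Integrable (fun x => Real.exp ((|T Q u β θ f x| / c) ^ r)) Q₀ :=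
    (hi1.add hi2).mono' (aemeasurable_exp_rpow hT.aemeasurable r c).aestronglyMeasurable
      (hbound.mono fun x hx => by rwa [Real.norm_eq_abs, Real.abs_exp])
  refine ⟨hint, (integral_mono_ae hint (hi1.add hi2) hbound).trans ?_⟩
  simp only [Pi.add_apply]
  rw [integral_add hi1 hi2, integral_const_mul, integral_const_mul, integral_const_mul,
    integral_integral_of_invariant hQ hfi]
  set P := ∫ x, Real.exp ((|f x| / c) ^ r) ∂Q₀
  set R := E * ∫ x, ∫ y, Real.exp ((|h (x, y)| / d) ^ r) ∂Q x ∂Q₀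
  nlinarith [le_max_left P R, le_max_right P R]

theorem memHeart_T_of_one_le (hQ : Kernel.Invariant Q Q₀) (hr : 1 ≤ r)
    (hu : MemHeart r (Q₀ ⊗ₘ Q) u) (hβ0 : 0 < β) (hβ1 : β < 1) {f : X → ℝ}
    (hf : MemHeart r Q₀ f) : MemHeart r Q₀ (T Q u β θ f) := by
  refine memHeart_of_forall_le_half hr (memHeart_T hQ (hu.mono_exponent le_rfl hr)
    (hf.mono_exponent le_rfl hr)).aemeasurable fun c hc hc2 => ?_
  obtain ⟨C, hC⟩ := exists_integral_exp_T_rpow_le (θ := θ) hQ hr hu hβ0 hβ1 hc hc2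
  exact (hC f hf).1

theorem exp_abs_le_exp_rpow {r x : ℝ} (hr : 1 ≤ r) :
    Real.exp |x| ≤ Real.exp 1 * Real.exp ((|x| / (1 / 2)) ^ r) := by
  rw [← Real.exp_add, Real.exp_le_exp]
  have hx : 0 ≤ |x| / (1 / 2) := by positivity
  rcases le_total (|x| / (1 / 2)) 1 with h | h
  · have := Real.rpow_nonneg hx r
    have := abs_nonneg x
    linarith
  · have := Real.self_le_rpow_of_one_le h hr
    have := abs_nonneg x
    linarith

/-- By monotone convergence the supremum of `exp (g n)` has finite integral, hence is finite almost
everywhere. -/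
theorem ae_bddAbove_of_integral_exp_bounded {g : ℕ → X → ℝ} (hg : ∀ n, MemHeart 1 Q₀ (g n))
    (hmono : ∀ᵐ x ∂Q₀, Monotone fun n => g n x) {K : ℝ}
    (hK : ∀ n, ∫ x, Real.exp (g n x) ∂Q₀ ≤ K) :
    ∀ᵐ x ∂Q₀, BddAbove (Set.range fun n => g n x) := by
  have hm : ∀ n, AEMeasurable (fun x => ENNReal.ofReal (Real.exp (g n x))) Q₀ := fun n =>
    (Real.measurable_exp.comp_aemeasurable (hg n).aemeasurable).ennreal_ofReal
  have h1 : ∫⁻ x, ⨆ n, ENNReal.ofReal (Real.exp (g n x)) ∂Q₀ ≤ ENNReal.ofReal K := by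
    rw [lintegral_iSup' hm (hmono.mono fun x hx i j hij =>
      ENNReal.ofReal_le_ofReal (Real.exp_le_exp.2 (hx hij)))]
    refine iSup_le fun n => ?_
    rw [← ofReal_integral_eq_lintegral_ofReal (hg n).integrable_exp
      (ae_of_all _ fun x => (Real.exp_pos _).le)]
    exact ENNReal.ofReal_le_ofReal (hK n)
  filter_upwards [ae_lt_top' (AEMeasurable.iSup hm) (h1.trans_lt ENNReal.ofReal_lt_top).ne]
    with x hx
  set M := ⨆ n, ENNReal.ofReal (Real.exp (g n x))
  refine ⟨Real.log M.toReal, ?_⟩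
  rintro _ ⟨n, rfl⟩
  rw [Real.le_log_iff_exp_le]
  · exact (ENNReal.ofReal_le_iff_le_toReal hx.ne).1
      (le_iSup (fun n => ENNReal.ofReal (Real.exp (g n x))) n)
  · refine (Real.exp_pos (g n x)).trans_le ((ENNReal.ofReal_le_iff_le_toReal hx.ne).1
      (le_iSup (fun n => ENNReal.ofReal (Real.exp (g n x))) n))

theorem ae_tendsto_T_of_monotone (hQ : Kernel.Invariant Q Q₀) (hu : MemHeart 1 (Q₀ ⊗ₘ Q) u)
    {g : ℕ → X → ℝ} {v : X → ℝ} (hg : ∀ n, MemHeart 1 Q₀ (g n)) (hv : MemHeart 1 Q₀ v)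
    (hle : ∀ᵐ x ∂Q₀, ∀ n, g n x ≤ v x)
    (hlim : ∀ᵐ x ∂Q₀, Tendsto (fun n => g n x) atTop (𝓝 (v x))) :
    ∀ᵐ x ∂Q₀, Tendsto (fun n => T Q u β θ (g n) x) atTop (𝓝 (T Q u β θ v x)) := by
  have hs : ∀ᵐ x ∂Q₀, ∀ n, MemHeart 1 (Q x) fun y => g n y + alpha β θ * u (x, y) :=
    ae_all_iff.2 fun n => (memHeart_exponent (β := β) (θ := θ) hQ hu (hg n)).ae_section
  filter_upwards [hs, (memHeart_exponent (β := β) (θ := θ) hQ hu hv).ae_section,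
    ae_ae_of_ae_invariant hQ hle, ae_ae_of_ae_invariant hQ hlim] with x h1 h2 h3 h4
  refine Tendsto.const_mul β (Tendsto.log ?_ (integral_exp_pos h2.integrable_exp).ne')
  refine tendsto_integral_of_dominated_convergence
    (fun y => Real.exp (v y + alpha β θ * u (x, y)))
    (fun n => (h1 n).integrable_exp.aestronglyMeasurable) h2.integrable_exp (fun n => ?_) ?_
  · filter_upwards [h3] with y hy
    rw [Real.norm_eq_abs, Real.abs_exp]
    exact Real.exp_le_exp.2 (by linarith [hy n])
  · filter_upwards [h4] with y hy
    exact (Real.continuous_exp.tendsto _).comp (hy.add_const _)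

/-- A subsolution makes the iterates increase; the uniform modular bound makes their supremum finite
and places it in the heart, and dominated convergence passes `T` to the limit. -/
theorem exists_fixedPoint_of_le_T (hQ : Kernel.Invariant Q Q₀) (hr : 1 ≤ r)
    (hu : MemHeart r (Q₀ ⊗ₘ Q) u) (hβ0 : 0 < β) (hβ1 : β < 1) {g₀ : X → ℝ}
    (hg₀ : MemHeart r Q₀ g₀) (hle : g₀ ≤ᵐ[Q₀] T Q u β θ g₀) :
    ∃ v, IsFixedPoint r Q₀ Q u β θ v := by
  have hu1 := hu.mono_exponent le_rfl hr
  set g : ℕ → X → ℝ := fun n => (T Q u β θ)^[n] g₀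
  have hgs : ∀ n, g (n + 1) = T Q u β θ (g n) := fun n => Function.iterate_succ_apply' _ _ _
  have hg : ∀ n, MemHeart r Q₀ (g n) := fun n => by
    induction n with
    | zero => exact hg₀
    | succ n ih => rw [hgs]; exact memHeart_T_of_one_le hQ hr hu hβ0 hβ1 ih
  have hg1 : ∀ n, MemHeart 1 Q₀ (g n) := fun n => (hg n).mono_exponent le_rfl hr
  have hstep : ∀ n, g n ≤ᵐ[Q₀] g (n + 1) := fun n => by
    induction n with
    | zero => exact hle
    | succ n ih => rw [hgs, hgs (n + 1)]; exact T_mono hQ hu1 hβ0.le (hg1 _) (hg1 _) ih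
  have hmono : ∀ᵐ x ∂Q₀, Monotone fun n => g n x :=
    (ae_all_iff.2 hstep).mono fun x hx => monotone_nat_of_le_succ hx
  have hmod : ∀ c : ℝ, 0 < c → c ≤ 1 / 2 → ∃ K : ℝ, ∀ n,
      ∫ x, Real.exp ((|g n x| / c) ^ r) ∂Q₀ ≤ K := by
    intro c hc hc2
    obtain ⟨C, hC⟩ := exists_integral_exp_T_rpow_le (θ := θ) hQ hr hu hβ0 hβ1 hc hc2
    refine ⟨max (∫ x, Real.exp ((|g₀ x| / c) ^ r) ∂Q₀) C, fun n => ?_⟩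
    induction n with
    | zero => exact le_max_left _ _
    | succ n ih => rw [hgs]; exact (hC _ (hg n)).2.trans (max_le ih (le_max_right _ _))
  have hint : ∀ c : ℝ, 0 < c → ∀ n, Integrable (fun x => Real.exp ((|g n x| / c) ^ r)) Q₀ :=
    fun c hc n => ((memHeart_iff hr).1 (hg n)).2 c hc
  obtain ⟨K, hK⟩ := hmod (1 / 2) (by norm_num) le_rfl
  have hbdd := ae_bddAbove_of_integral_exp_bounded hg1 hmono (K := Real.exp 1 * K) fun n => by
    refine le_trans (integral_mono (hg1 n).integrable_exp
      ((hint (1 / 2) (by norm_num) n).const_mul (Real.exp 1)) fun x =>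
        (Real.exp_le_exp.2 (le_abs_self _)).trans (exp_abs_le_exp_rpow hr)) ?_
    rw [integral_const_mul]
    exact mul_le_mul_of_nonneg_left (hK n) (Real.exp_pos _).le
  set v : X → ℝ := fun x => ⨆ n, g n x
  have hlim : ∀ᵐ x ∂Q₀, Tendsto (fun n => g n x) atTop (𝓝 (v x)) := by
    filter_upwards [hmono, hbdd] with x h1 h2
    exact tendsto_atTop_ciSup h1 h2
  have hgv : ∀ᵐ x ∂Q₀, ∀ n, g n x ≤ v x := by
    filter_upwards [hbdd] with x h2 n
    exact le_ciSup h2 n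
  have hv : MemHeart r Q₀ v := by
    refine memHeart_of_forall_le_half hr (aemeasurable_of_tendsto_metrizable_ae atTop
      (fun n => (hg n).aemeasurable) hlim) fun c hc hc2 => ?_
    obtain ⟨K, hK⟩ := hmod c hc hc2
    refine integrable_of_tendsto_of_integral_le (hint c hc) (fun _ _ => (Real.exp_pos _).le) hK
      (fun _ => (Real.exp_pos _).le) (hlim.mono fun x hx => ?_)
    exact (Real.continuous_exp.tendsto _).comp
      ((hx.abs.div_const c).rpow_const (Or.inr (by linarith)))
  refine ⟨v, hv, ?_⟩
  filter_upwards [ae_tendsto_T_of_monotone (β := β) (θ := θ) hQ hu1 hg1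
    (hv.mono_exponent le_rfl hr) hgv hlim, hlim] with x h1 h2
  refine tendsto_nhds_unique h1 ?_
  simp only [← hgs]
  exact h2.comp (tendsto_add_atTop_nat 1)

theorem exists_fixedPoint (hQ : Kernel.Invariant Q Q₀) (hr : 1 ≤ r)
    (hu : MemHeart r (Q₀ ⊗ₘ Q) u) (hβ0 : 0 < β) (hβ1 : β < 1) (hθ : 0 < θ) :
    ∃ v, IsFixedPoint r Q₀ Q u β θ v := by
  have hα : alpha β θ ≤ 0 := by
    have : 0 < 1 - β := by linarith
    have : 0 ≤ 1 / (θ * (1 - β)) := by positivity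
    unfold alpha
    linarith
  have hu' : MemHeart r (Q₀ ⊗ₘ Q) fun p => -|u p| := (hu.abs hr).neg hr
  have hu1 := hu.mono_exponent le_rfl hr
  have hu1' := hu'.mono_exponent le_rfl hr
  have h0 : MemHeart 1 Q₀ fun _ => (0 : ℝ) := memHeart_const le_rfl 0
  -- For `-|u|` the exponent `α (-|u|)` is nonnegative since `α ≤ 0`, so by Jensen `0` is a
  -- subsolution.
  obtain ⟨W, hW, hWT⟩ := exists_fixedPoint_of_le_T (θ := θ) hQ hr hu' hβ0 hβ1
    (memHeart_const hr 0) (by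
      filter_upwards [(memHeart_exponent (β := β) (θ := θ) hQ hu1' h0).ae_section] with x h1
      refine mul_nonneg hβ0.le (le_trans (integral_nonneg fun y => ?_)
        (integral_le_log_integral_exp h1))
      simp only [Pi.zero_apply, zero_add, mul_neg]
      nlinarith [abs_nonneg (u (x, y))])
  have hW1 := hW.mono_exponent le_rfl hr
  -- `-W` is a subsolution for `u`: with `F = -W + α u`, Jensen gives `log E e^F ≥ -log E e^{-F}`,
  -- and `-F ≤ W + α (-|u|)`.
  refine exists_fixedPoint_of_le_T hQ hr hu hβ0 hβ1 (hW.neg hr) ?_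
  have hG := memHeart_exponent (β := β) (θ := θ) hQ hu1 (hW1.neg le_rfl)
  filter_upwards [hWT, neg_entropic_neg_le hG, entropic_mono (hG.neg le_rfl)
    (memHeart_exponent (β := β) (θ := θ) hQ hu1' hW1)
    (ae_of_all _ fun p => by
      have := mul_le_mul_of_nonpos_left (le_abs_self (u p)) hα
      linarith)] with x h1 h2 h3
  rw [← h1]
  simp only [T_eq_entropic]
  rw [← mul_neg]
  exact mul_le_mul_of_nonneg_left (by linarith) hβ0.le

end Existence

end RobustValue

end

/-- `Q` is the Markov kernel of `X_{t+1}` given `X_t`, `Q₀` a stationary law of `X_t`, and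
`Q₀ ⊗ₘ Q` the law of `(X_t, X_{t+1})`. The first two conjuncts say that the operators and
spectral radii in the claim are well defined. The function `v` is then the unique fixed point of `T`
in every `E^{φ_s}` with `1 < s ≤ r`; it is the smallest fixed point and the only stable one
in `E^{φ_1}`. -/
theorem proposition3p1 {X : Type*} [MeasurableSpace X]
    (Q₀ : Measure X) [IsProbabilityMeasure Q₀]
    (Q : Kernel X X) [IsMarkovKernel Q] (hQ : Kernel.Invariant Q Q₀)
    (β θ : ℝ) (hβ₀ : 0 < β) (hβ₁ : β < 1) (hθ : 0 < θ)
    (u : X × X → ℝ) (r : ℝ) (hr : 1 < r) (hu : RobustValue.MemHeart r (Q₀ ⊗ₘ Q) u) :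
    (∀ f : X → ℝ, RobustValue.MemHeart 1 Q₀ f →
      RobustValue.MemHeart 1 Q₀ (RobustValue.T Q u β θ f)) ∧
    (∀ w : X → ℝ, RobustValue.IsFixedPoint 1 Q₀ Q u β θ w →
      (∀ f : X → ℝ, RobustValue.MemHeart 1 Q₀ f →
        RobustValue.MemHeart 1 Q₀ (RobustValue.D Q u β θ w f)) ∧
      RobustValue.heartOpNorm 1 Q₀ (RobustValue.D Q u β θ w) < ∞ ∧
      Tendsto (RobustValue.rootNorm 1 Q₀ (RobustValue.D Q u β θ w)) atTop
        (𝓝 (RobustValue.heartSpectralRadius 1 Q₀ (RobustValue.D Q u β θ w)))) ∧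
    ∃ v : X → ℝ,
      (∀ s : ℝ, 1 < s → s ≤ r →
        RobustValue.IsFixedPoint s Q₀ Q u β θ v ∧
        ∀ w : X → ℝ, RobustValue.IsFixedPoint s Q₀ Q u β θ w → w =ᵐ[Q₀] v) ∧
      RobustValue.IsFixedPoint 1 Q₀ Q u β θ v ∧
      (∀ w : X → ℝ, RobustValue.IsFixedPoint 1 Q₀ Q u β θ w → v ≤ᵐ[Q₀] w) ∧
      RobustValue.IsStable Q₀ Q u β θ v ∧
      (∀ w : X → ℝ, RobustValue.IsFixedPoint 1 Q₀ Q u β θ w →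
        RobustValue.IsStable Q₀ Q u β θ w → w =ᵐ[Q₀] v) := by
  have hu1 := hu.mono_exponent le_rfl hr.le
  obtain ⟨v, hv⟩ := RobustValue.exists_fixedPoint hQ hr.le hu hβ₀ hβ₁ hθ
  have hv1 : RobustValue.IsFixedPoint 1 Q₀ Q u β θ v := ⟨hv.1.mono_exponent le_rfl hr.le, hv.2⟩
  have huniq : ∀ w, RobustValue.IsFixedPoint 1 Q₀ Q u β θ w → w =ᵐ[Q₀] v := fun w hw =>
    (hw.ae_le hQ hu1 hβ₀ hβ₁ hv1).antisymm (hv1.ae_le hQ hu1 hβ₀ hβ₁ hw)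
  exact ⟨fun f hf => RobustValue.memHeart_T hQ hu1 hf,
    fun w hw => ⟨fun f hf => RobustValue.memHeart_D hQ hu1 hw.1 hf,
      RobustValue.heartOpNorm_D_iterate_lt_top hQ hu1 hw.1 hβ₀ 1,
      RobustValue.tendsto_rootNorm_D hQ hu1 hw.1 hβ₀⟩,
    v, fun s hs hsr => ⟨⟨hv.1.mono_exponent hs.le hsr, hv.2⟩,
      fun w hw => huniq w ⟨hw.1.mono_exponent le_rfl hs.le, hw.2⟩⟩,
    hv1, fun w hw => hv1.ae_le hQ hu1 hβ₀ hβ₁ hw,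
    RobustValue.isStable_of_memHeart hQ hu1 hv1.1 hβ₀ hβ₁,
    fun w hw _ => huniq w hw⟩
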